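/- **Soundness and completeness of the calculus $\mathbf G_{\nabla\Delta}$.** *Functor.* Let $\mathsf{Pos}$ be the category of posets and monotone maps. Let $T:\mathsf{Pos}\to\mathsf{Pos}$ be a functor that is finitary (preserves filtered colimits), locally monotone ($f\le g$ pointwise implies $Tf\le Tg$ pointwise), preserves exact squares, and preserves finite intersections (pullbacks) of order-embeddings. Here a square $p_0:P\to A$, $p_1:P\to B$, $f:A\to C$, $g:B\to C$ with $fp_0\le gp_1$ is exact if $fa\le gb$ implies that there is $w\in P$ with $a\le p_0w$ and $p_1w\le b$. Put $T^\partial X=(TX^{op})^{op}$. Let $U_\omega X$ be the poset of finitely generated uppersets of $X$ ordered by reversed inclusion and $L_\omega X$ the poset of finitely generated lowersets ordered by inclusion; both are functors, a monotone map acting by direct image followed by closure. *Base and lifting.* For a functor $G$ on $\mathsf{Pos}$ and $\alpha\in GX$, $\mathrm{base}(\alpha)$ is the least subposet $S\subseteq X$ such that $\alpha$ lies in the image of $GS\to GX$. For $R\subseteq Y\times X$, regarded as a subposet of $Y\times X$ with projections $p_0,p_1$, the lifting $\overline G R\subseteq GY\times GX$ relates $\beta$ to $\alpha$ iff there is $w\in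 G(R)$ with $\beta\le Gp_0(w)$ and $Gp_1(w)\le\alpha$. Negations $\not\sqni,\not\sqin,\not\Vdash$ of relations are taken between the opposite posets. *Language.* Fix a poset $\mathsf{At}$ of atoms. The poset $\mathcal L$ of formulas is the free algebra on $\mathsf{At}$, in $\mathsf{Pos}$, for $U_\omega+L_\omega+T^\partial+T^\partial$ (the colimit of $W_0=\mathsf{At}$, $W_{n+1}=U_\omega W_n+L_\omega W_n+T^\partial W_n+T^\partial W_n+\mathsf{At}$), with operations $\bigwedge:U_\omega\mathcal L\to\mathcal L$, $\bigvee:L_\omega\mathcal L\to\mathcal L$, $\nabla,\Delta:T^\partial\mathcal L\to\mathcal L$. *Semantics.* Given a coalgebra $c:X\to TX$ and a monotone valuation (a relation $x\Vdash p$ between states and atoms that is upward closed in both arguments), $\Vdash$ is extended to $\mathcal L$ by: $x\Vdash\bigwedge\phi$ iff $x\Vdash a$ for all $a\in\phi$; $x\Vdash\bigvee\psi$ iff $x\Vdash a$ for some $a\in\psi$; $x\Vdash\nabla\alpha$ iff $c(x)\mathrel{\overline{T^\partial}{\Vdash}}\alpha$, with $\Vdash$ regarded as a relation between $X^{op}$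 and $\mathcal L$; $x\not\Vdash\Delta\alpha$ iff $c(x)\mathrel{\overline T{\not\Vdash}}\alpha$, with $\not\Vdash$ regarded as a relation between $X$ and $\mathcal L^{op}$. A sequent $\phi\Rightarrow\psi$ consists of $\phi\in U_\omega\mathcal L$ and $\psi\in L_\omega\mathcal L$. It is valid if for all $T$-coalgebras, all monotone valuations and all states $x$, $x\Vdash\bigwedge\phi$ implies $x\Vdash\bigvee\psi$. *Calculus.* In sequents, a comma denotes union and a formula denotes the upperset (on the left) or lowerset (on the right) that it generates. A sequent is provable if it is the root of a well-founded, possibly infinitely branching, tree built from the following rules. - Axioms $a\Rightarrow b$ for $a\le_{\mathcal L}b$. - Weakening: from $\phi\Rightarrow\psi$ infer $\phi\Rightarrow\xi,\psi$ and infer $\phi,\xi\Rightarrow\psi$. - $\bigwedge$-r: from $\phi\Rightarrow a,\psi$ for all $a\in\xi$ infer $\phi\Rightarrow\bigwedge\xi,\psi$. $\bigwedge$-l: from $\phi,\xi\Rightarrow\psi$ infer $\phi,\bigwedge\xi\Rightarrow\psi$. - $\bigvee$-r: from $\phi\Rightarrow\psi,\xi$ infer $\phi\Rightarrow\psi,\bigvee\xi$.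 $\bigvee$-l: from $\phi,a\Rightarrow\psi$ for all $a\in\xi$ infer $\phi,\bigvee\xi\Rightarrow\psi$. - $\nabla$-r: from $\phi\Rightarrow\Delta(T^\partial\bigvee)\Psi,\psi$ for all $\Psi\in R_\alpha$ infer $\phi\Rightarrow\nabla\alpha,\psi$, where $R_\alpha$ is the set of $\Psi\in T^\partial L_\omega\,\mathrm{base}(\alpha)$ for which $\alpha\mathrel{\overline T{\not\sqin}}\Psi$ fails. - $\Delta$-l: from $\phi,\nabla(T^\partial\bigwedge)\Phi\Rightarrow\psi$ for all $\Phi\in L_\beta$ infer $\phi,\Delta\beta\Rightarrow\psi$, where $L_\beta$ is the set of $\Phi\in T^\partial U_\omega\,\mathrm{base}(\beta)$ for which $\Phi\mathrel{\overline T{\not\sqni}}\beta$ fails. - $\nabla\Delta$: let $A\in U_\omega T^\partial\mathcal L$ and $B\in L_\omega T^\partial\mathcal L$. A redistribution of $(A,B)$ is an element $\Phi\in T^\partial(U_\omega\,\mathrm{base}(A)\times L_\omega\,\mathrm{base}(B))$, viewed in $T^\partial(U_\omega\mathcal L\times L_\omega\mathcal L)$, such that $(T^\partial p_0)\Phi\mathrel{\overline{T^\partial}{\sqni}}\alpha$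 for all $\alpha\in A$ and $\beta\mathrel{\overline{T^\partial}{\sqin}}(T^\partial p_1)\Phi$ for all $\beta\in B$; here $p_0,p_1$ are the product projections, and $\mathrm{base}(A)$, $\mathrm{base}(B)$ are subposets of $\mathcal L$, taken for the functors $U_\omega T^\partial$ and $L_\omega T^\partial$. If $z^\Phi\in\mathrm{base}(\Phi)$ is chosen for every redistribution $\Phi$ of $(A,B)$, then from $p_0(z^\Phi)\Rightarrow p_1(z^\Phi)$ for all these $\Phi$ infer $\{\nabla\alpha\mid\alpha\in A\}\Rightarrow\{\Delta\beta\mid\beta\in B\}$. **Theorem.** For every poset $\mathsf{At}$, every sequent $\phi\Rightarrow\psi$ is valid if and only if it is provable in $\mathbf G_{\nabla\Delta}$. -/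

import Mathlib

open CategoryTheory CategoryTheory.Limits

universe u

namespace MossPos

/-! ### Endofunctors of the category of posets -/

/-- `T` is locally monotone: `f ≤ g` pointwise implies `T f ≤ T g` pointwise. -/
def LocallyMonotone (T : PartOrd.{u} ⥤ PartOrd.{u}) : Prop :=
  ∀ ⦃X Y : PartOrd.{u}⦄ (f g : X ⟶ Y), (∀ x, f x ≤ g x) → ∀ t, T.map f t ≤ T.map g t

/-- The lax square `f ∘ p₀ ≤ g ∘ p₁` is exact. -/
def IsExactSquare {P A B C : PartOrd.{u}} (p₀ : P ⟶ A) (p₁ : P ⟶ B) (f : A ⟶ C) (g : B ⟶ C) :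
    Prop :=
  (∀ w, f (p₀ w) ≤ g (p₁ w)) ∧ ∀ a b, f a ≤ g b → ∃ w, a ≤ p₀ w ∧ p₁ w ≤ b

/-- `T` preserves exact squares (the Beck-Chevalley condition). -/
def PreservesExactSquares (T : PartOrd.{u} ⥤ PartOrd.{u}) : Prop :=
  ∀ ⦃P A B C : PartOrd.{u}⦄ (p₀ : P ⟶ A) (p₁ : P ⟶ B) (f : A ⟶ C) (g : B ⟶ C),
    IsExactSquare p₀ p₁ f g → IsExactSquare (T.map p₀) (T.map p₁) (T.map f) (T.map g)

/-- A morphism of posets is an order-embedding. -/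
def IsEmb {X Y : PartOrd.{u}} (m : X ⟶ Y) : Prop :=
  ∀ x y, m x ≤ m y → x ≤ y

/-- `T` preserves (binary, hence finite) intersections of order-embeddings, the intersection of
two subobjects being their pullback. -/
def PreservesFiniteIntersections (T : PartOrd.{u} ⥤ PartOrd.{u}) : Prop :=
  ∀ ⦃P A B X : PartOrd.{u}⦄ (i : P ⟶ A) (j : P ⟶ B) (m : A ⟶ X) (n : B ⟶ X),
    IsEmb m → IsEmb n → IsPullback i j m n → IsPullback (T.map i) (T.map j) (T.map m) (T.map n)

/-- The dual functor `T^∂ X = (T Xᵒᵖ)ᵒᵖ`. -/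
def dualFunctor (T : PartOrd.{u} ⥤ PartOrd.{u}) : PartOrd.{u} ⥤ PartOrd.{u} :=
  PartOrd.dual ⋙ T ⋙ PartOrd.dual

/-- The inclusion of a subset of a poset, with the induced order. -/
def incl {X : PartOrd.{u}} (S : Set X) : PartOrd.of S ⟶ X :=
  PartOrd.ofHom (OrderHom.Subtype.val (· ∈ S))

/-- The base of `α ∈ G X`: the intersection of all subposets `S` of `X` with `α ∈ G S`. Whenever
there is a least such `S`, it is this one. -/
def base (G : PartOrd.{u} ⥤ PartOrd.{u}) {X : PartOrd.{u}} (α : G.obj X) : Set X :=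
  ⋂₀ {S : Set X | α ∈ Set.range (G.map (incl S))}

/-! ### Relation lifting -/

/-- The graph of a relation, as a subposet of the product. -/
abbrev graph {Y X : PartOrd.{u}} (R : Y → X → Prop) : PartOrd.{u} :=
  PartOrd.of {p : Y × X // R p.1 p.2}

/-- The first projection of the graph. -/
def graphFst {Y X : PartOrd.{u}} (R : Y → X → Prop) : graph R ⟶ Y :=
  PartOrd.ofHom ⟨fun p => p.1.1, fun _ _ h => h.1⟩

/-- The second projection of the graph. -/
def graphSnd {Y X : PartOrd.{u}} (R : Y → X → Prop) : graph R ⟶ X :=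
  PartOrd.ofHom ⟨fun p => p.1.2, fun _ _ h => h.2⟩

/-- The lifting along `G` of a monotone relation `R` from `X` to `Y`. Relations are written
`R y x`; monotone means that `R y x`, `y' ≤ y` and `x ≤ x'` imply `R y' x'`. -/
def lift (G : PartOrd.{u} ⥤ PartOrd.{u}) {Y X : PartOrd.{u}} (R : Y → X → Prop)
    (β : G.obj Y) (α : G.obj X) : Prop :=
  ∃ w : G.obj (graph R), β ≤ G.map (graphFst R) w ∧ G.map (graphSnd R) w ≤ α

/-! ### Finitely generated uppersets and lowersets -/

/-- Finitely generated uppersets of `X`, ordered by reversed inclusion. -/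
def FinUp (X : Type u) [PartialOrder X] : Type u :=
  {U : UpperSet X // ∃ s : Set X, s.Finite ∧ U = upperClosure s}

/-- Finitely generated lowersets of `X`, ordered by inclusion. -/
def FinLow (X : Type u) [PartialOrder X] : Type u :=
  {L : LowerSet X // ∃ s : Set X, s.Finite ∧ L = lowerClosure s}

namespace FinUp

variable {X Y : Type u} [PartialOrder X] [PartialOrder Y]

instance : PartialOrder (FinUp X) := inferInstanceAs (PartialOrder (Subtype _))

instance : Membership X (FinUp X) := ⟨fun U a => a ∈ U.1⟩

/-- The upperset generated by one element. -/
instance : Singleton X (FinUp X) :=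
  ⟨fun a => ⟨upperClosure {a}, {a}, Set.finite_singleton a, rfl⟩⟩

/-- The union of two uppersets (which is their infimum for reversed inclusion). -/
instance : Union (FinUp X) :=
  ⟨fun U V => ⟨U.1 ⊓ V.1, by
    obtain ⟨s, hs, h⟩ := U.2
    obtain ⟨t, ht, h'⟩ := V.2
    exact ⟨s ∪ t, hs.union ht, by rw [upperClosure_union, h, h']⟩⟩⟩

theorem le_iff {U V : FinUp X} : U ≤ V ↔ ∀ a ∈ V, a ∈ U := Iff.rfl

theorem mem_of_le {U : FinUp X} {a b : X} (h : a ≤ b) (ha : a ∈ U) : b ∈ U := U.1.upper h ha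

/-- `f` sends an upperset to the upperset generated by its image. -/
def map (f : X →o Y) : FinUp X →o FinUp Y where
  toFun U := ⟨upperClosure (f '' {a | a ∈ U}), by
    obtain ⟨s, hs, h⟩ := U.2
    refine ⟨f '' s, hs.image f, ?_⟩
    apply SetLike.coe_injective
    ext y
    simp only [SetLike.mem_coe, mem_upperClosure, Set.mem_image]
    constructor
    · rintro ⟨_, ⟨a, ha, rfl⟩, hy⟩
      have ha' : a ∈ U.1 := ha
      rw [h, mem_upperClosure] at ha'
      obtain ⟨b, hb, hba⟩ := ha'
      exact ⟨f b, ⟨b, hb, rfl⟩, (f.monotone hba).trans hy⟩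
    · rintro ⟨_, ⟨a, ha, rfl⟩, hy⟩
      refine ⟨f a, ⟨a, ?_, rfl⟩, hy⟩
      change a ∈ U.1
      rw [h]
      exact subset_upperClosure ha⟩
  monotone' U V h := by
    change upperClosure _ ≤ upperClosure _
    exact upperClosure_anti (Set.image_mono fun a ha => h ha)

theorem mem_map {f : X →o Y} {U : FinUp X} {y : Y} : y ∈ map f U ↔ ∃ a ∈ U, f a ≤ y := by
  change y ∈ upperClosure (f '' {a | a ∈ U}) ↔ _
  simp [mem_upperClosure]

theorem ext {U V : FinUp X} (h : ∀ a, a ∈ U ↔ a ∈ V) : U = V :=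
  Subtype.ext (SetLike.ext h)

end FinUp

namespace FinLow

variable {X Y : Type u} [PartialOrder X] [PartialOrder Y]

instance : PartialOrder (FinLow X) := inferInstanceAs (PartialOrder (Subtype _))

instance : Membership X (FinLow X) := ⟨fun L a => a ∈ L.1⟩

/-- The lowerset generated by one element. -/
instance : Singleton X (FinLow X) :=
  ⟨fun a => ⟨lowerClosure {a}, {a}, Set.finite_singleton a, rfl⟩⟩

/-- The union of two lowersets. -/
instance : Union (FinLow X) :=
  ⟨fun U V => ⟨U.1 ⊔ V.1, by
    obtain ⟨s, hs, h⟩ := U.2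
    obtain ⟨t, ht, h'⟩ := V.2
    exact ⟨s ∪ t, hs.union ht, by rw [lowerClosure_union, h, h']⟩⟩⟩

theorem le_iff {U V : FinLow X} : U ≤ V ↔ ∀ a ∈ U, a ∈ V := Iff.rfl

theorem mem_of_le {U : FinLow X} {a b : X} (h : a ≤ b) (hb : b ∈ U) : a ∈ U := U.1.lower h hb

/-- `f` sends a lowerset to the lowerset generated by its image. -/
def map (f : X →o Y) : FinLow X →o FinLow Y where
  toFun U := ⟨lowerClosure (f '' {a | a ∈ U}), by
    obtain ⟨s, hs, h⟩ := U.2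
    refine ⟨f '' s, hs.image f, ?_⟩
    apply SetLike.coe_injective
    ext y
    simp only [SetLike.mem_coe, mem_lowerClosure, Set.mem_image]
    constructor
    · rintro ⟨_, ⟨a, ha, rfl⟩, hy⟩
      have ha' : a ∈ U.1 := ha
      rw [h, mem_lowerClosure] at ha'
      obtain ⟨b, hb, hba⟩ := ha'
      exact ⟨f b, ⟨b, hb, rfl⟩, hy.trans (f.monotone hba)⟩
    · rintro ⟨_, ⟨a, ha, rfl⟩, hy⟩
      refine ⟨f a, ⟨a, ?_, rfl⟩, hy⟩
      change a ∈ U.1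
      rw [h]
      exact subset_lowerClosure ha⟩
  monotone' U V h := by
    change lowerClosure _ ≤ lowerClosure _
    exact lowerClosure_mono (Set.image_mono fun a ha => h ha)

theorem mem_map {f : X →o Y} {U : FinLow X} {y : Y} : y ∈ map f U ↔ ∃ a ∈ U, y ≤ f a := by
  change y ∈ lowerClosure (f '' {a | a ∈ U}) ↔ _
  simp [mem_lowerClosure]

theorem ext {U V : FinLow X} (h : ∀ a, a ∈ U ↔ a ∈ V) : U = V :=
  Subtype.ext (SetLike.ext h)

end FinLow

/-- The functor of finitely generated uppersets. -/
def upFunctor : PartOrd.{u} ⥤ PartOrd.{u} where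
  obj X := PartOrd.of (FinUp X)
  map f := PartOrd.ofHom (FinUp.map f.hom)
  map_id X := by
    ext U
    refine FinUp.ext fun a => ?_
    refine FinUp.mem_map.trans ⟨?_, fun h => ⟨a, h, le_rfl⟩⟩
    rintro ⟨b, hb, h⟩
    exact FinUp.mem_of_le h hb
  map_comp f g := by
    ext U
    refine FinUp.ext fun a => FinUp.mem_map.trans (Iff.trans ?_ FinUp.mem_map.symm)
    constructor
    · rintro ⟨b, hb, h⟩
      exact ⟨f b, FinUp.mem_map.2 ⟨b, hb, le_rfl⟩, h⟩
    · rintro ⟨b, hb, h⟩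
      obtain ⟨c, hc, h'⟩ := FinUp.mem_map.1 hb
      exact ⟨c, hc, (g.hom.monotone h').trans h⟩

/-- The functor of finitely generated lowersets. -/
def lowFunctor : PartOrd.{u} ⥤ PartOrd.{u} where
  obj X := PartOrd.of (FinLow X)
  map f := PartOrd.ofHom (FinLow.map f.hom)
  map_id X := by
    ext U
    refine FinLow.ext fun a => ?_
    refine FinLow.mem_map.trans ⟨?_, fun h => ⟨a, h, le_rfl⟩⟩
    rintro ⟨b, hb, h⟩
    exact FinLow.mem_of_le h hb
  map_comp f g := by
    ext U
    refine FinLow.ext fun a => FinLow.mem_map.trans (Iff.trans ?_ FinLow.mem_map.symm)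
    constructor
    · rintro ⟨b, hb, h⟩
      exact ⟨f b, FinLow.mem_map.2 ⟨b, hb, le_rfl⟩, h⟩
    · rintro ⟨b, hb, h⟩
      obtain ⟨c, hc, h'⟩ := FinLow.mem_map.1 hb
      exact ⟨c, hc, h.trans (g.hom.monotone h')⟩

/-! ### Colimits of sequences of posets -/

section SeqColim

variable (D : ℕ ⥤ PartOrd.{u})

/-- Elements of all stages of a sequence of posets. -/
structure PreColim : Type u where
  /-- the stage -/
  stage : ℕ
  /-- the element -/
  val : D.obj stage

/-- `a` at stage `n` is below `b` at stage `m` if this holds at some later stage. -/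
instance : Preorder (PreColim D) where
  le p q := ∃ (k : ℕ) (hp : p.stage ≤ k) (hq : q.stage ≤ k),
    D.map (homOfLE hp) p.val ≤ D.map (homOfLE hq) q.val
  le_refl p := ⟨p.stage, le_rfl, le_rfl, le_rfl⟩
  le_trans := by
    rintro p q r ⟨k, hp, hq, h⟩ ⟨l, hq', hr, h'⟩
    have e : ∀ {i j m : ℕ} (hij : i ≤ j) (hjm : j ≤ m) (x : D.obj i),
        D.map (homOfLE hjm) (D.map (homOfLE hij) x) = D.map (homOfLE (hij.trans hjm)) x := by
      intro i j m hij hjm x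
      rw [← PartOrd.comp_apply, ← D.map_comp]
      rfl
    refine ⟨max k l, hp.trans (le_max_left _ _), hr.trans (le_max_right _ _), ?_⟩
    have h1 := (D.map (homOfLE (le_max_left k l))).hom.monotone h
    have h2 := (D.map (homOfLE (le_max_right k l))).hom.monotone h'
    have h1' : D.map (homOfLE (le_max_left k l)) (D.map (homOfLE hp) p.2) ≤
      D.map (homOfLE (le_max_left k l)) (D.map (homOfLE hq) q.2) := h1
    have h2' : D.map (homOfLE (le_max_right k l)) (D.map (homOfLE hq') q.2) ≤
      D.map (homOfLE (le_max_right k l)) (D.map (homOfLE hr) r.2) := h2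
    rw [e, e] at h1' h2'
    exact h1'.trans h2'

/-- The colimit of a sequence of posets. -/
def colimPt : PartOrd.{u} := PartOrd.of (Antisymmetrization (PreColim D) (· ≤ ·))

/-- The colimit injections. -/
def colimInj (n : ℕ) : D.obj n ⟶ colimPt D :=
  PartOrd.ofHom ⟨fun a => toAntisymmetrization (· ≤ ·) (⟨n, a⟩ : PreColim D),
    fun a b h =>
      toAntisymmetrization_mono (show (⟨n, a⟩ : PreColim D) ≤ ⟨n, b⟩ from
        ⟨n, le_rfl, le_rfl, (D.map _).hom.monotone h⟩)⟩

theorem colimInj_le_iff {n m : ℕ} {a : D.obj n} {b : D.obj m} :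
    colimInj D n a ≤ colimInj D m b ↔
      ∃ (k : ℕ) (hn : n ≤ k) (hm : m ≤ k), D.map (homOfLE hn) a ≤ D.map (homOfLE hm) b :=
  Iff.rfl

theorem colimInj_surj (x : colimPt D) : ∃ n a, colimInj D n a = x := by
  induction x using Quotient.inductionOn' with
  | h p => exact ⟨p.1, p.2, rfl⟩

theorem colimInj_map {n m : ℕ} (h : n ≤ m) (a : D.obj n) :
    colimInj D m (D.map (homOfLE h) a) = colimInj D n a := by
  apply le_antisymm
  · refine (colimInj_le_iff D).2 ⟨m, le_rfl, h, ?_⟩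
    have : D.map (homOfLE (le_refl m)) = 𝟙 _ := D.map_id m
    rw [this]
    exact le_rfl
  · refine (colimInj_le_iff D).2 ⟨m, h, le_rfl, ?_⟩
    have : D.map (homOfLE (le_refl m)) = 𝟙 _ := D.map_id m
    rw [this]
    exact le_rfl

/-- The colimit cocone of a sequence of posets. -/
def colimCocone : Cocone D where
  pt := colimPt D
  ι :=
    { app := fun n => colimInj D n
      naturality := fun n m f => by
        ext a
        exact colimInj_map D (leOfHom f) a }

variable {D}

/-- Jointly surjective and order-reflecting cocones over sequences of posets are colimits. -/
noncomputable def isColimitOfElements (c : Cocone D) (hs : ∀ x : c.pt, ∃ n a, c.ι.app n a = x)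
    (hr : ∀ (n m : ℕ) (a : D.obj n) (b : D.obj m), c.ι.app n a ≤ c.ι.app m b →
      ∃ (k : ℕ) (hn : n ≤ k) (hm : m ≤ k), D.map (homOfLE hn) a ≤ D.map (homOfLE hm) b) :
    IsColimit c := by
  have key : ∀ (s : Cocone D) (n m : ℕ) (a : D.obj n) (b : D.obj m),
      c.ι.app n a ≤ c.ι.app m b → s.ι.app n a ≤ s.ι.app m b := by
    intro s n m a b h
    obtain ⟨k, hn, hm, h'⟩ := hr n m a b h
    have h2 : s.ι.app k (D.map (homOfLE hn) a) ≤ s.ι.app k (D.map (homOfLE hm) b) :=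
      (s.ι.app k).hom.monotone h'
    have e1 : s.ι.app k (D.map (homOfLE hn) a) = s.ι.app n a :=
      ConcreteCategory.congr_hom (s.w (homOfLE hn)) a
    have e2 : s.ι.app k (D.map (homOfLE hm) b) = s.ι.app m b :=
      ConcreteCategory.congr_hom (s.w (homOfLE hm)) b
    rwa [e1, e2] at h2
  choose N A hA using hs
  exact
    { desc := fun s => PartOrd.ofHom ⟨fun x => s.ι.app (N x) (A x), fun x y h =>
        key s _ _ _ _ (by rw [hA, hA]; exact h)⟩
      fac := fun s n => by
        ext a
        exact le_antisymm (key s _ _ _ _ (hA _).le) (key s _ _ _ _ (hA _).ge)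
      uniq := fun s m hm => by
        ext x
        have h := ConcreteCategory.congr_hom (hm (N x)) (A x)
        have h' : m (c.ι.app (N x) (A x)) = s.ι.app (N x) (A x) := h
        rw [hA] at h'
        exact h' }

variable (D)

/-- The cocone `colimCocone` is a colimit cocone. -/
noncomputable def isColimitColimCocone : IsColimit (colimCocone D) :=
  isColimitOfElements _ (colimInj_surj D) fun _ _ _ _ h => (colimInj_le_iff D).1 h

theorem finite_lift {s : Set (colimPt D)} (hs : s.Finite) :
    ∃ (n : ℕ) (t : Set (D.obj n)), t.Finite ∧ colimInj D n '' t = s := by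
  induction s, hs using Set.Finite.induction_on with
  | empty => exact ⟨0, ∅, Set.finite_empty, Set.image_empty _⟩
  | @insert x s _ _ ih =>
    obtain ⟨n, t, ht, h⟩ := ih
    obtain ⟨m, a, rfl⟩ := colimInj_surj D x
    refine ⟨max n m, insert (D.map (homOfLE (le_max_right n m)) a)
      (D.map (homOfLE (le_max_left n m)) '' t), (ht.image _).insert _, ?_⟩
    rw [Set.image_insert_eq, Set.image_image, colimInj_map, ← h]
    congr 1
    exact Set.image_congr fun b _ => colimInj_map D _ b

/-- If every element of a finite set of stage `n` is related to a fixed-stage witness at some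
later stage, then one later stage works for the whole set. -/
theorem uniform_stage {n : ℕ} {s : Set (D.obj n)} (hs : s.Finite) (Q : D.obj n → ℕ → Prop)
    (hQ : ∀ a i j, i ≤ j → Q a i → Q a j) (h : ∀ a ∈ s, ∃ k, Q a k) :
    ∃ k, ∀ a ∈ s, Q a k := by
  choose! f hf using h
  obtain ⟨k, hk⟩ := (hs.image f).bddAbove
  exact ⟨k, fun a ha => hQ a _ _ (hk ⟨a, ha, rfl⟩) (hf a ha)⟩

theorem map_map {i j m : ℕ} (hij : i ≤ j) (hjm : j ≤ m) (x : D.obj i) :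
    D.map (homOfLE hjm) (D.map (homOfLE hij) x) = D.map (homOfLE (hij.trans hjm)) x := by
  rw [← PartOrd.comp_apply, ← D.map_comp]
  rfl

theorem up_surj (U : FinUp (colimPt D)) :
    ∃ (n : ℕ) (V : FinUp (D.obj n)), FinUp.map (colimInj D n).hom V = U := by
  obtain ⟨s, hs, hU⟩ := U.2
  obtain ⟨n, t, ht, rfl⟩ := finite_lift D hs
  refine ⟨n, ⟨upperClosure t, t, ht, rfl⟩, FinUp.ext fun y => FinUp.mem_map.trans ?_⟩
  have hy : y ∈ U ↔ y ∈ U.1 := Iff.rfl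
  rw [hy, hU, mem_upperClosure]
  constructor
  · rintro ⟨a, ha, h⟩
    obtain ⟨b, hb, hba⟩ := mem_upperClosure.1 (show a ∈ upperClosure t from ha)
    exact ⟨_, ⟨b, hb, rfl⟩, ((colimInj D n).hom.monotone hba).trans (h)⟩
  · rintro ⟨_, ⟨a, ha, rfl⟩, h⟩
    exact ⟨a, subset_upperClosure ha, h⟩

theorem up_reflect {n m : ℕ} (U : FinUp (D.obj n)) (V : FinUp (D.obj m))
    (h : FinUp.map (colimInj D n).hom U ≤ FinUp.map (colimInj D m).hom V) :
    ∃ (k : ℕ) (hn : n ≤ k) (hm : m ≤ k),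
      FinUp.map (D.map (homOfLE hn)).hom U ≤ FinUp.map (D.map (homOfLE hm)).hom V := by
  obtain ⟨s, hs, hV⟩ := V.2
  have h1 : ∀ b ∈ s, ∃ k, ∃ (hm : m ≤ k) (hn : n ≤ k), ∃ a ∈ U,
      D.map (homOfLE hn) a ≤ D.map (homOfLE hm) b := by
    intro b hb
    have hb' : b ∈ V := by
      change b ∈ V.1
      rw [hV]
      exact subset_upperClosure hb
    obtain ⟨a, ha, hab⟩ := FinUp.mem_map.1 (FinUp.le_iff.1 h _ (FinUp.mem_map.2 ⟨b, hb', le_rfl⟩))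
    obtain ⟨k, hn, hm, hk⟩ := (colimInj_le_iff D).1 hab
    exact ⟨k, hm, hn, a, ha, hk⟩
  obtain ⟨k, hk⟩ := uniform_stage D hs _ (by
    rintro b i j hij ⟨hm, hn, a, ha, hle⟩
    refine ⟨hm.trans hij, hn.trans hij, a, ha, ?_⟩
    rw [← map_map D hn hij, ← map_map D hm hij]
    exact (D.map _).hom.monotone hle) h1
  refine ⟨max k (max n m), (le_max_left n m).trans (le_max_right _ _),
    (le_max_right n m).trans (le_max_right _ _), ?_⟩
  refine FinUp.le_iff.2 fun y hy => ?_
  obtain ⟨b, hb, hby⟩ := FinUp.mem_map.1 hy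
  obtain ⟨b', hb', hbb⟩ := mem_upperClosure.1 (show b ∈ upperClosure s from hV ▸ hb)
  obtain ⟨hm, hn, a, ha, hle⟩ := hk b' hb'
  have h3 : D.map (homOfLE (le_max_left k (max n m))) (D.map (homOfLE hn) a) ≤ D.map (homOfLE (le_max_left k (max n m))) (D.map (homOfLE hm) b') :=
    (D.map (homOfLE (le_max_left k (max n m)))).hom.monotone hle
  rw [map_map, map_map] at h3
  exact FinUp.mem_map.2 ⟨a, ha, (h3.trans ((D.map _).hom.monotone hbb)).trans hby⟩

instance : PreservesColimit D upFunctor.{u} :=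
  preservesColimit_of_preserves_colimit_cocone (isColimitColimCocone D)
    (isColimitOfElements _ (up_surj D) (fun _ _ U V h => up_reflect D U V h))

theorem low_surj (U : FinLow (colimPt D)) :
    ∃ (n : ℕ) (V : FinLow (D.obj n)), FinLow.map (colimInj D n).hom V = U := by
  obtain ⟨s, hs, hU⟩ := U.2
  obtain ⟨n, t, ht, rfl⟩ := finite_lift D hs
  refine ⟨n, ⟨lowerClosure t, t, ht, rfl⟩, FinLow.ext fun y => FinLow.mem_map.trans ?_⟩
  have hy : y ∈ U ↔ y ∈ U.1 := Iff.rfl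
  rw [hy, hU, mem_lowerClosure]
  constructor
  · rintro ⟨a, ha, h⟩
    obtain ⟨b, hb, hba⟩ := mem_lowerClosure.1 (show a ∈ lowerClosure t from ha)
    exact ⟨_, ⟨b, hb, rfl⟩, (h).trans ((colimInj D n).hom.monotone hba)⟩
  · rintro ⟨_, ⟨a, ha, rfl⟩, h⟩
    exact ⟨a, subset_lowerClosure ha, h⟩

theorem low_reflect {n m : ℕ} (U : FinLow (D.obj n)) (V : FinLow (D.obj m))
    (h : FinLow.map (colimInj D m).hom V ≤ FinLow.map (colimInj D n).hom U) :
    ∃ (k : ℕ) (hn : n ≤ k) (hm : m ≤ k),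
      FinLow.map (D.map (homOfLE hm)).hom V ≤ FinLow.map (D.map (homOfLE hn)).hom U := by
  obtain ⟨s, hs, hV⟩ := V.2
  have h1 : ∀ b ∈ s, ∃ k, ∃ (hm : m ≤ k) (hn : n ≤ k), ∃ a ∈ U,
      D.map (homOfLE hm) b ≤ D.map (homOfLE hn) a := by
    intro b hb
    have hb' : b ∈ V := by
      change b ∈ V.1
      rw [hV]
      exact subset_lowerClosure hb
    obtain ⟨a, ha, hab⟩ := FinLow.mem_map.1 (FinLow.le_iff.1 h _ (FinLow.mem_map.2 ⟨b, hb', le_rfl⟩))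
    obtain ⟨k, hm, hn, hk⟩ := (colimInj_le_iff D).1 hab
    exact ⟨k, hm, hn, a, ha, hk⟩
  obtain ⟨k, hk⟩ := uniform_stage D hs _ (by
    rintro b i j hij ⟨hm, hn, a, ha, hle⟩
    refine ⟨hm.trans hij, hn.trans hij, a, ha, ?_⟩
    rw [← map_map D hn hij, ← map_map D hm hij]
    exact (D.map _).hom.monotone hle) h1
  refine ⟨max k (max n m), (le_max_left n m).trans (le_max_right _ _),
    (le_max_right n m).trans (le_max_right _ _), ?_⟩
  refine FinLow.le_iff.2 fun y hy => ?_
  obtain ⟨b, hb, hby⟩ := FinLow.mem_map.1 hy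
  obtain ⟨b', hb', hbb⟩ := mem_lowerClosure.1 (show b ∈ lowerClosure s from hV ▸ hb)
  obtain ⟨hm, hn, a, ha, hle⟩ := hk b' hb'
  have h3 : D.map (homOfLE (le_max_left k (max n m))) (D.map (homOfLE hm) b') ≤ D.map (homOfLE (le_max_left k (max n m))) (D.map (homOfLE hn) a) :=
    (D.map (homOfLE (le_max_left k (max n m)))).hom.monotone hle
  rw [map_map, map_map] at h3
  exact FinLow.mem_map.2 ⟨a, ha, hby.trans (((D.map _).hom.monotone hbb).trans h3)⟩

instance : PreservesColimit D lowFunctor.{u} :=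
  preservesColimit_of_preserves_colimit_cocone (isColimitColimCocone D)
    (isColimitOfElements _ (low_surj D) (fun n m U V h => by
      obtain ⟨k, hm, hn, h'⟩ := low_reflect D V U h
      exact ⟨k, hn, hm, h'⟩))

end SeqColim

/-! ### The language -/

section Language

variable (T : PartOrd.{u} ⥤ PartOrd.{u}) (At : PartOrd.{u})

/-- The functor `X ↦ U_ω X + L_ω X + T^∂ X + T^∂ X + At`; the summands are the arities of `⋀`, `⋁`,
`∇`, `Δ` and the atoms. -/
def layer : PartOrd.{u} ⥤ PartOrd.{u} where
  obj X := PartOrd.of (upFunctor.obj X ⊕ lowFunctor.obj X ⊕ (dualFunctor T).obj X ⊕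
    (dualFunctor T).obj X ⊕ At)
  map f := PartOrd.ofHom
    ⟨Sum.map (upFunctor.map f) (Sum.map (lowFunctor.map f)
      (Sum.map ((dualFunctor T).map f) (Sum.map ((dualFunctor T).map f) id))), by
      have hmap : ∀ {A B A' B' : Type u} [PartialOrder A] [PartialOrder B] [PartialOrder A']
          [PartialOrder B'] {g : A → A'} {h : B → B'}, Monotone g → Monotone h →
          Monotone (Sum.map g h) := by
        rintro A B A' B' _ _ _ _ g h hg hh (a | a) (b | b) hab
        · exact Sum.inl_le_inl_iff.2 (hg (Sum.inl_le_inl_iff.1 hab))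
        · exact absurd hab Sum.not_inl_le_inr
        · exact absurd hab Sum.not_inr_le_inl
        · exact Sum.inr_le_inr_iff.2 (hh (Sum.inr_le_inr_iff.1 hab))
      exact hmap (upFunctor.map f).hom.monotone (hmap (lowFunctor.map f).hom.monotone
        (hmap ((dualFunctor T).map f).hom.monotone
          (hmap ((dualFunctor T).map f).hom.monotone monotone_id)))⟩
  map_id X := by
    ext x
    rcases x with x | x | x | x | x <;> simp
  map_comp f g := by
    ext x
    rcases x with x | x | x | x | x <;> simp

/-- The coproduct injections into `layer`. -/
def inUp : upFunctor.{u} ⟶ layer T At where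
  app X := PartOrd.ofHom ⟨Sum.inl, Sum.inl_mono⟩

def inLow : lowFunctor.{u} ⟶ layer T At where
  app X := PartOrd.ofHom ⟨fun a => Sum.inr (Sum.inl a), Sum.inr_mono.comp Sum.inl_mono⟩

def inNabla : dualFunctor T ⟶ layer T At where
  app X := PartOrd.ofHom ⟨fun a => Sum.inr (Sum.inr (Sum.inl a)),
    Sum.inr_mono.comp (Sum.inr_mono.comp Sum.inl_mono)⟩

def inDelta : dualFunctor T ⟶ layer T At where
  app X := PartOrd.ofHom ⟨fun a => Sum.inr (Sum.inr (Sum.inr (Sum.inl a))),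
    Sum.inr_mono.comp (Sum.inr_mono.comp (Sum.inr_mono.comp Sum.inl_mono))⟩

def inAtom (X : PartOrd.{u}) : At ⟶ (layer T At).obj X :=
  PartOrd.ofHom ⟨fun a => Sum.inr (Sum.inr (Sum.inr (Sum.inr a))),
    Sum.inr_mono.comp (Sum.inr_mono.comp (Sum.inr_mono.comp Sum.inr_mono))⟩

/-- The stages `W₀ = At`, `W_{n+1} = F W_n + At` of the construction of the language. -/
def stage : ℕ → PartOrd.{u}
  | 0 => At
  | n + 1 => (layer T At).obj (stage n)

/-- The connecting morphisms of the construction of the language. -/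
def stageMap : ∀ n : ℕ, stage T At n ⟶ stage T At (n + 1)
  | 0 => inAtom T At At
  | n + 1 => (layer T At).map (stageMap n)

/-- The sequence `W₀ ⟶ W₁ ⟶ ⋯`. -/
def stageSeq : ℕ ⥤ PartOrd.{u} := Functor.ofSequence (stageMap T At)

/-- The poset of formulas: the free algebra on `At` for `U_ω + L_ω + T^∂ + T^∂`, constructed as the
colimit of `stageSeq`. -/
def Lang : PartOrd.{u} := colimPt (stageSeq T At)

/-- The colimit injections `W_n ⟶ Lang`. -/
def stageInj (n : ℕ) : stage T At n ⟶ Lang T At := colimInj (stageSeq T At) n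

variable {T At} in
theorem stageSeq_map_succ (n : ℕ) :
    (stageSeq T At).map (homOfLE (Nat.le_add_right n 1)) = stageMap T At n :=
  Functor.ofSequence_map_homOfLE_succ _ n

theorem stageInj_stageMap (n : ℕ) (a : stage T At n) :
    stageInj T At (n + 1) (stageMap T At n a) = stageInj T At n a := by
  rw [← stageSeq_map_succ]
  exact colimInj_map (stageSeq T At) (Nat.le_add_right n 1) a

instance [PreservesFilteredColimits T] (D : ℕ ⥤ PartOrd.{u}) :
    PreservesColimit D (dualFunctor T) := by
  have : PreservesFilteredColimitsOfSize.{0, 0} T :=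
    preservesSmallestFilteredColimits_of_preservesFilteredColimits T
  have : PartOrd.dual.{u}.IsEquivalence := PartOrd.dualEquiv.{u}.isEquivalence_functor
  unfold dualFunctor
  infer_instance

/-- The operation `G Lang ⟶ Lang` induced by a summand `G` of `layer`: on the image of `G W_n` it is
the injection `G W_n ⟶ W_{n+1}`. -/
noncomputable def operation (G : PartOrd.{u} ⥤ PartOrd.{u}) [PreservesColimit (stageSeq T At) G]
    (i : G ⟶ layer T At) : G.obj (Lang T At) ⟶ Lang T At :=
  (isColimitOfPreserves G (isColimitColimCocone (stageSeq T At))).desc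
    { pt := Lang T At
      ι := NatTrans.ofSequence (F := stageSeq T At ⋙ G) (G := (Functor.const ℕ).obj (Lang T At))
        (fun n => i.app (stage T At n) ≫ stageInj T At (n + 1)) (fun n => by
          change G.map ((stageSeq T At).map _) ≫ _ = _ ≫ 𝟙 _
          erw [stageSeq_map_succ, Category.comp_id, i.naturality_assoc]
          congr 1
          ext a
          exact stageInj_stageMap T At (n + 1) a) }

theorem operation_stage (G : PartOrd.{u} ⥤ PartOrd.{u}) [PreservesColimit (stageSeq T At) G]
    (i : G ⟶ layer T At) (n : ℕ) (a : G.obj (stage T At n)) :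
    operation T At G i (G.map (stageInj T At n) a) =
      stageInj T At (n + 1) (i.app (stage T At n) a) :=
  ConcreteCategory.congr_hom
    ((isColimitOfPreserves G (isColimitColimCocone (stageSeq T At))).fac _ n) a

/-- Atoms as formulas. -/
def atom : At ⟶ Lang T At := stageInj T At 0

/-- Conjunction. -/
noncomputable def conj : upFunctor.obj (Lang T At) ⟶ Lang T At :=
  operation T At upFunctor (inUp T At)

/-- Disjunction. -/
noncomputable def disj : lowFunctor.obj (Lang T At) ⟶ Lang T At :=
  operation T At lowFunctor (inLow T At)

/-- The modality `∇`. -/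
noncomputable def nabla [PreservesFilteredColimits T] :
    (dualFunctor T).obj (Lang T At) ⟶ Lang T At :=
  operation T At (dualFunctor T) (inNabla T At)

/-- The modality `Δ`. -/
noncomputable def delta [PreservesFilteredColimits T] :
    (dualFunctor T).obj (Lang T At) ⟶ Lang T At :=
  operation T At (dualFunctor T) (inDelta T At)

end Language

/-! ### Semantics -/

section Semantics

variable {T : PartOrd.{u} ⥤ PartOrd.{u}} {At : PartOrd.{u}} {X : PartOrd.{u}}

/-- A monotone valuation of the atoms on a poset `X`. -/
structure Valuation (At X : PartOrd.{u}) where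
  /-- `holds x p`: the atom `p` holds in the state `x`. -/
  holds : X → At → Prop
  mono : ∀ ⦃x x' : X⦄ ⦃p p' : At⦄, x ≤ x' → p ≤ p' → holds x p → holds x' p'

/-- A coalgebra `c : X ⟶ T X` as the monotone map `Xᵒᵖ ⟶ T^∂ (Xᵒᵖ) = (T X)ᵒᵖ`. -/
def coalgDual (c : X ⟶ T.obj X) : PartOrd.dual.obj X ⟶ (dualFunctor T).obj (PartOrd.dual.obj X) :=
  PartOrd.dual.map (c ≫ T.map (PartOrd.dualEquiv.unitIso.hom.app X))

/-- `c(x) T̄^∂(S) α`, for a relation `S` between states and formulas. -/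
def liftNabla (c : X ⟶ T.obj X) {W : PartOrd.{u}} (S : X → W → Prop) (x : X)
    (α : (dualFunctor T).obj W) : Prop :=
  lift (dualFunctor T) (Y := PartOrd.dual.obj X) (X := W)
    (fun y a => S (OrderDual.ofDual y) a) (coalgDual c (OrderDual.toDual x)) α

/-- `c(x) T̄(¬S) α`, for a relation `S` between states and formulas. -/
def liftDelta (c : X ⟶ T.obj X) {W : PartOrd.{u}} (S : X → W → Prop) (x : X)
    (α : (dualFunctor T).obj W) : Prop :=
  lift T (Y := X) (X := PartOrd.dual.obj W)
    (fun y a => ¬ S y (OrderDual.ofDual a)) (c x) (OrderDual.ofDual α)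

/-- One step of the inductive definition of satisfaction. -/
def satLayer (c : X ⟶ T.obj X) (v : Valuation At X) {W : PartOrd.{u}} (S : X → W → Prop) (x : X) :
    FinUp W ⊕ FinLow W ⊕ (dualFunctor T).obj W ⊕ (dualFunctor T).obj W ⊕ At → Prop
  | .inl φ => ∀ a ∈ φ, S x a
  | .inr (.inl ψ) => ∃ a ∈ ψ, S x a
  | .inr (.inr (.inl α)) => liftNabla c S x α
  | .inr (.inr (.inr (.inl α))) => ¬ liftDelta c S x α
  | .inr (.inr (.inr (.inr p))) => v.holds x p

/-- Satisfaction of the formulas of stage `n`. -/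
def satStage (c : X ⟶ T.obj X) (v : Valuation At X) : ∀ n : ℕ, X → stage T At n → Prop
  | 0, x, p => v.holds x p
  | n + 1, x, a => satLayer c v (satStage c v n) x a

/-- `Sat c v x a` : the formula `a` holds in the state `x` of the coalgebra `c` under the
valuation `v`. -/
def Sat (c : X ⟶ T.obj X) (v : Valuation At X) (x : X) (a : Lang T At) : Prop :=
  ∃ (n : ℕ) (b : stage T At n), stageInj T At n b = a ∧ satStage c v n x b

/-! The recursive clauses of the semantics. -/

theorem lift_mono {G : PartOrd.{u} ⥤ PartOrd.{u}} {Y X : PartOrd.{u}} {R : Y → X → Prop}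
    {β β' : G.obj Y} {α α' : G.obj X} (hβ : β' ≤ β) (hα : α ≤ α') (h : lift G R β α) :
    lift G R β' α' := by
  obtain ⟨w, h0, h1⟩ := h
  exact ⟨w, hβ.trans h0, h1.trans hα⟩

theorem PreservesExactSquares.dual (h : PreservesExactSquares T) :
    PreservesExactSquares (dualFunctor T) := by
  have key : ∀ {P A B C : PartOrd.{u}} {p₀ : P ⟶ A} {p₁ : P ⟶ B} {f : A ⟶ C} {g : B ⟶ C},
      IsExactSquare p₀ p₁ f g → IsExactSquare (PartOrd.dual.map p₁) (PartOrd.dual.map p₀)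
        (PartOrd.dual.map g) (PartOrd.dual.map f) := by
    rintro P A B C p₀ p₁ f g ⟨h1, h2⟩
    refine ⟨fun w => h1 w, fun b a hab => ?_⟩
    obtain ⟨w, hw, hw'⟩ := h2 a b hab
    exact ⟨w, hw', hw⟩
  intro P A B C p₀ p₁ f g hs
  exact key (h _ _ _ _ (key hs))

/-- The comma square of `f` and `g` is exact. -/
theorem exists_of_comma {G : PartOrd.{u} ⥤ PartOrd.{u}} (h : PreservesExactSquares G)
    {A B C : PartOrd.{u}} (f : A ⟶ C) (g : B ⟶ C) (a : G.obj A) (b : G.obj B)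
    (hab : G.map f a ≤ G.map g b) :
    ∃ w : G.obj (graph fun a b => f a ≤ g b),
      a ≤ G.map (graphFst _) w ∧ G.map (graphSnd _) w ≤ b :=
  (h (graphFst _) (graphSnd _) f g
    ⟨fun w => w.2, fun a b hab => ⟨⟨(a, b), hab⟩, le_rfl, le_rfl⟩⟩).2 a b hab

theorem map_apply_comp (G : PartOrd.{u} ⥤ PartOrd.{u}) {A B C : PartOrd.{u}} (f : A ⟶ B)
    (g : B ⟶ C) (a : G.obj A) : G.map g (G.map f a) = G.map (f ≫ g) a := by
  rw [G.map_comp, PartOrd.comp_apply]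

/-- Relation lifting commutes with restrictions. -/
theorem lift_restrict {G : PartOrd.{u} ⥤ PartOrd.{u}} (hG : PreservesExactSquares G)
    {A B Y X : PartOrd.{u}} {R : Y → X → Prop}
    (hR : ∀ y y' x x', y' ≤ y → x ≤ x' → R y x → R y' x') (f : B ⟶ Y) (g : A ⟶ X)
    {R' : B → A → Prop} (hR' : ∀ b a, R' b a ↔ R (f b) (g a)) (β : G.obj B) (α : G.obj A) :
    lift G R' β α ↔ lift G R (G.map f β) (G.map g α) := by
  constructor
  · rintro ⟨w, h0, h1⟩
    let k : graph R' ⟶ graph R := PartOrd.ofHom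
      ⟨fun p => ⟨(f p.1.1, g p.1.2), (hR' _ _).1 p.2⟩,
        fun p q h => ⟨f.hom.monotone h.1, g.hom.monotone h.2⟩⟩
    refine ⟨G.map k w, ?_, ?_⟩
    · refine ((G.map f).hom.monotone h0).trans_eq ?_
      exact (map_apply_comp G _ _ w).trans (map_apply_comp G k (graphFst R) w).symm
    · refine le_of_eq_of_le ?_ ((G.map g).hom.monotone h1)
      exact (map_apply_comp G k (graphSnd R) w).trans (map_apply_comp G (graphSnd R') g w).symm
  · rintro ⟨w, h0, h1⟩
    obtain ⟨w1, h2, h3⟩ := exists_of_comma hG f (graphFst R) β w h0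
    have h4 : G.map (graphSnd _ ≫ graphSnd R) w1 ≤ G.map g α := by
      rw [← map_apply_comp]
      exact ((G.map (graphSnd R)).hom.monotone h3).trans h1
    obtain ⟨w2, h5, h6⟩ := exists_of_comma hG _ g w1 α h4
    let k : graph (fun (a : graph fun b e => f b ≤ graphFst R e) b =>
        (graphSnd _ ≫ graphSnd R) a ≤ g b) ⟶ graph R' := PartOrd.ofHom
      ⟨fun p => ⟨(p.1.1.1.1, p.1.2), (hR' _ _).2
          (hR _ _ _ _ p.1.1.2 p.2 p.1.1.1.2.2)⟩,
        fun p q h => ⟨h.1.1, h.2⟩⟩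
    refine ⟨G.map k w2, ?_, ?_⟩
    · refine h2.trans (((G.map (graphFst _)).hom.monotone h5).trans_eq ?_)
      exact (map_apply_comp G _ _ w2).trans (map_apply_comp G k (graphFst R') w2).symm
    · refine le_of_eq_of_le ?_ h6
      exact map_apply_comp G k (graphSnd R') w2

theorem liftNabla_restrict (hT : PreservesExactSquares T) (c : X ⟶ T.obj X) {W W' : PartOrd.{u}}
    {S : X → W → Prop} (hS : ∀ x x' a a', x ≤ x' → a ≤ a' → S x a → S x' a') (f : W' ⟶ W)
    {S' : X → W' → Prop} (hS' : ∀ x a, S' x a ↔ S x (f a)) (x : X) (α : (dualFunctor T).obj W') :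
    liftNabla c S' x α ↔ liftNabla c S x ((dualFunctor T).map f α) := by
  have h := lift_restrict hT.dual (Y := PartOrd.dual.obj X) (X := W)
    (R := fun y a => S (OrderDual.ofDual y) a) (fun y y' a a' hy ha h => hS _ _ _ _ hy ha h)
    (𝟙 _) f (R' := fun y a => S' (OrderDual.ofDual y) a) (fun y a => hS' _ _)
    (coalgDual c (OrderDual.toDual x)) α
  rw [(dualFunctor T).map_id] at h
  exact h

theorem liftDelta_restrict (hT : PreservesExactSquares T) (c : X ⟶ T.obj X) {W W' : PartOrd.{u}}
    {S : X → W → Prop} (hS : ∀ x x' a a', x ≤ x' → a ≤ a' → S x a → S x' a') (f : W' ⟶ W)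
    {S' : X → W' → Prop} (hS' : ∀ x a, S' x a ↔ S x (f a)) (x : X) (α : (dualFunctor T).obj W') :
    liftDelta c S' x α ↔ liftDelta c S x ((dualFunctor T).map f α) := by
  have h := lift_restrict hT (Y := X) (X := PartOrd.dual.obj W)
    (R := fun y a => ¬ S y (OrderDual.ofDual a))
    (fun y y' a a' hy ha h h' => h (hS _ _ _ _ hy ha h'))
    (𝟙 _) (PartOrd.dual.map f) (R' := fun y a => ¬ S' y (OrderDual.ofDual a))
    (fun y a => not_congr (hS' _ _)) (c x) (OrderDual.ofDual α)
  rw [T.map_id] at h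
  exact h

theorem satStage_mono (c : X ⟶ T.obj X) (v : Valuation At X) (n : ℕ) :
    ∀ (x x' : X) (a a' : stage T At n), x ≤ x' → a ≤ a' → satStage c v n x a →
      satStage c v n x' a' := by
  induction n with
  | zero => exact fun x x' a a' hx ha h => v.mono hx ha h
  | succ n ih =>
    have main : ∀ (x x' : X) (a a' : FinUp (stage T At n) ⊕ FinLow (stage T At n) ⊕
        (dualFunctor T).obj (stage T At n) ⊕ (dualFunctor T).obj (stage T At n) ⊕ At), x ≤ x' →
        a ≤ a' → satLayer c v (satStage c v n) x a → satLayer c v (satStage c v n) x' a' := by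
      rintro x x' (a | a | a | a | a) (b | b | b | b | b) hx hab h <;>
        simp only [Sum.inl_le_inl_iff, Sum.inr_le_inr_iff, Sum.not_inl_le_inr,
          Sum.not_inr_le_inl] at hab
      · exact fun d hd => ih _ _ _ _ hx le_rfl (h d (FinUp.le_iff.1 hab d hd))
      · obtain ⟨d, hd, h⟩ := h
        exact ⟨d, FinLow.le_iff.1 hab d hd, ih _ _ _ _ hx le_rfl h⟩
      · exact lift_mono ((coalgDual c).hom.monotone hx) hab h
      · exact fun h' => h (lift_mono (c.hom.monotone hx) hab h')
      · exact v.mono hx hab h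
    exact main

theorem satStage_stageMap (hT : PreservesExactSquares T) (c : X ⟶ T.obj X) (v : Valuation At X)
    (n : ℕ) : ∀ (x : X) (a : stage T At n),
      satStage c v (n + 1) x (stageMap T At n a) ↔ satStage c v n x a := by
  induction n with
  | zero => exact fun x a => Iff.rfl
  | succ n ih =>
    have main : ∀ (x : X) (a : FinUp (stage T At n) ⊕ FinLow (stage T At n) ⊕
        (dualFunctor T).obj (stage T At n) ⊕ (dualFunctor T).obj (stage T At n) ⊕ At),
        satStage c v (n + 1 + 1) x (stageMap T At (n + 1) a) ↔
          satLayer c v (satStage c v n) x a := by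
      have hm := satStage_mono c v (n + 1)
      rintro x (a | a | a | a | a)
      · constructor
        · exact fun h d hd => (ih x d).1 (h _ (FinUp.mem_map.2 ⟨d, hd, le_rfl⟩))
        · intro h d hd
          obtain ⟨e, he, hed⟩ := FinUp.mem_map.1 hd
          exact hm _ _ _ _ le_rfl hed ((ih x e).2 (h e he))
      · constructor
        · rintro ⟨d, hd, h⟩
          obtain ⟨e, he, hed⟩ := FinLow.mem_map.1 hd
          exact ⟨e, he, (ih x e).1 (hm _ _ _ _ le_rfl hed h)⟩
        · rintro ⟨d, hd, h⟩
          exact ⟨_, FinLow.mem_map.2 ⟨d, hd, le_rfl⟩, (ih x d).2 h⟩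
      · exact (liftNabla_restrict hT c hm (stageMap T At n) (fun x a => (ih x a).symm) x a).symm
      · exact not_congr
          (liftDelta_restrict hT c hm (stageMap T At n) (fun x a => (ih x a).symm) x a).symm
      · exact Iff.rfl
    exact main

theorem satStage_map (hT : PreservesExactSquares T) (c : X ⟶ T.obj X) (v : Valuation At X)
    {n m : ℕ} (h : n ≤ m) (x : X) (a : stage T At n) :
    satStage c v m x ((stageSeq T At).map (homOfLE h) a) ↔ satStage c v n x a := by
  induction m, h using Nat.le_induction with
  | base =>
    have : (stageSeq T At).map (homOfLE (le_refl n)) = 𝟙 _ := (stageSeq T At).map_id n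
    rw [this]
    exact Iff.rfl
  | succ m h ih =>
    have e : (stageSeq T At).map (homOfLE (h.trans (Nat.le_add_right m 1))) a =
        stageMap T At m ((stageSeq T At).map (homOfLE h) a) := by
      rw [← stageSeq_map_succ]
      exact (map_map (stageSeq T At) h (Nat.le_add_right m 1) a).symm
    exact (iff_of_eq (congrArg (satStage c v (m + 1) x) e)).trans
      ((satStage_stageMap hT c v m x _).trans ih)

theorem sat_stage (hT : PreservesExactSquares T) (c : X ⟶ T.obj X) (v : Valuation At X)
    (n : ℕ) (x : X) (a : stage T At n) :
    Sat c v x (stageInj T At n a) ↔ satStage c v n x a := by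
  refine ⟨?_, fun h => ⟨n, a, rfl, h⟩⟩
  rintro ⟨m, b, hb, h⟩
  obtain ⟨k, hm, hn, hk⟩ := (colimInj_le_iff (stageSeq T At)).1 hb.le
  exact (satStage_map hT c v hn x a).1
    (satStage_mono c v k _ _ _ _ le_rfl hk ((satStage_map hT c v hm x b).2 h))

theorem sat_mono (hT : PreservesExactSquares T) (c : X ⟶ T.obj X) (v : Valuation At X)
    (x x' : X) (a a' : Lang T At) (hx : x ≤ x') (ha : a ≤ a') (h : Sat c v x a) :
    Sat c v x' a' := by
  obtain ⟨n, b, rfl⟩ := colimInj_surj (stageSeq T At) a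
  obtain ⟨m, b', rfl⟩ := colimInj_surj (stageSeq T At) a'
  obtain ⟨k, hn, hm, hk⟩ := (colimInj_le_iff (stageSeq T At)).1 ha
  refine (sat_stage hT c v m x' b').2 ((satStage_map hT c v hm x' b').1 ?_)
  exact satStage_mono c v k _ _ _ _ hx hk
    ((satStage_map hT c v hn x b).2 ((sat_stage hT c v n x b).1 h))

theorem sat_atom (hT : PreservesExactSquares T) (c : X ⟶ T.obj X) (v : Valuation At X)
    (x : X) (p : At) : Sat c v x (atom T At p) ↔ v.holds x p :=
  sat_stage hT c v 0 x p

theorem sat_conj (hT : PreservesExactSquares T) (c : X ⟶ T.obj X) (v : Valuation At X)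
    (x : X) (φ : FinUp (Lang T At)) : Sat c v x (conj T At φ) ↔ ∀ a ∈ φ, Sat c v x a := by
  obtain ⟨n, φ, rfl⟩ := up_surj (stageSeq T At) φ
  have e := operation_stage T At upFunctor (inUp T At) n φ
  refine (iff_of_eq (congrArg (Sat c v x) e)).trans ((sat_stage hT c v (n + 1) x _).trans ?_)
  constructor
  · intro h a ha
    obtain ⟨b, hb, hba⟩ := FinUp.mem_map.1 ha
    exact sat_mono hT c v _ _ _ _ le_rfl hba ((sat_stage hT c v n x b).2 (h b hb))
  · exact fun h a ha => (sat_stage hT c v n x a).1 (h _ (FinUp.mem_map.2 ⟨a, ha, le_rfl⟩))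

theorem sat_disj (hT : PreservesExactSquares T) (c : X ⟶ T.obj X) (v : Valuation At X)
    (x : X) (ψ : FinLow (Lang T At)) : Sat c v x (disj T At ψ) ↔ ∃ a ∈ ψ, Sat c v x a := by
  obtain ⟨n, ψ, rfl⟩ := low_surj (stageSeq T At) ψ
  have e := operation_stage T At lowFunctor (inLow T At) n ψ
  refine (iff_of_eq (congrArg (Sat c v x) e)).trans ((sat_stage hT c v (n + 1) x _).trans ?_)
  constructor
  · rintro ⟨a, ha, h⟩
    exact ⟨_, FinLow.mem_map.2 ⟨a, ha, le_rfl⟩, (sat_stage hT c v n x a).2 h⟩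
  · rintro ⟨a, ha, h⟩
    obtain ⟨b, hb, hba⟩ := FinLow.mem_map.1 ha
    exact ⟨b, hb, (sat_stage hT c v n x b).1 (sat_mono hT c v _ _ _ _ le_rfl hba h)⟩

/-- Every element of `T^∂ Lang` comes from some stage. -/
theorem dual_surj [PreservesFilteredColimits T] (α : (dualFunctor T).obj (Lang T At)) :
    ∃ (n : ℕ) (α' : (dualFunctor T).obj (stage T At n)),
      (dualFunctor T).map (stageInj T At n) α' = α := by
  let D := stageSeq T At ⋙ dualFunctor T
  let h1 := isColimitOfPreserves (dualFunctor T) (isColimitColimCocone (stageSeq T At))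
  let e := h1.coconePointUniqueUpToIso (isColimitColimCocone D)
  obtain ⟨n, a, ha⟩ := colimInj_surj D (e.hom α)
  refine ⟨n, a, ?_⟩
  have h2 : e.hom ((dualFunctor T).map (stageInj T At n) a) = colimInj D n a :=
    ConcreteCategory.congr_hom
      (h1.comp_coconePointUniqueUpToIso_hom (isColimitColimCocone D) n) a
  have h3 := congrArg e.inv (h2.trans ha)
  exact ((PartOrd.inv_hom_apply e _).symm.trans h3).trans (PartOrd.inv_hom_apply e α)

theorem sat_nabla [PreservesFilteredColimits T] (hT : PreservesExactSquares T) (c : X ⟶ T.obj X)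
    (v : Valuation At X) (x : X) (α : (dualFunctor T).obj (Lang T At)) :
    Sat c v x (nabla T At α) ↔ liftNabla c (Sat c v) x α := by
  obtain ⟨n, α, rfl⟩ := dual_surj α
  have e := operation_stage T At (dualFunctor T) (inNabla T At) n α
  refine (iff_of_eq (congrArg (Sat c v x) e)).trans ((sat_stage hT c v (n + 1) x _).trans ?_)
  exact liftNabla_restrict hT c (sat_mono hT c v) (stageInj T At n)
    (fun x a => (sat_stage hT c v n x a).symm) x α

theorem sat_delta [PreservesFilteredColimits T] (hT : PreservesExactSquares T) (c : X ⟶ T.obj X)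
    (v : Valuation At X) (x : X) (α : (dualFunctor T).obj (Lang T At)) :
    ¬ Sat c v x (delta T At α) ↔ liftDelta c (Sat c v) x α := by
  obtain ⟨n, α, rfl⟩ := dual_surj α
  have e := operation_stage T At (dualFunctor T) (inDelta T At) n α
  refine (not_congr ((iff_of_eq (congrArg (Sat c v x) e)).trans
    (sat_stage hT c v (n + 1) x _))).trans (not_not.trans ?_)
  exact liftDelta_restrict hT c (sat_mono hT c v) (stageInj T At n)
    (fun x a => (sat_stage hT c v n x a).symm) x α

variable (T At) in
/-- The sequent `φ ⇒ ψ` is valid: in no state of a coalgebra, under no valuation, `⋀ φ` holds while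
`⋁ ψ` fails. -/
def Valid (φ : FinUp (Lang T At)) (ψ : FinLow (Lang T At)) : Prop :=
  ∀ (X : PartOrd.{u}) (c : X ⟶ T.obj X) (v : Valuation At X) (x : X),
    Sat c v x (conj T At φ) → Sat c v x (disj T At ψ)

end Semantics

/-! ### The sequent calculus -/

section Calculus

variable (T : PartOrd.{u} ⥤ PartOrd.{u}) (At : PartOrd.{u})

/-- The collection `R_α` of all `Ψ ∈ T^∂ L_ω base(α)` with `α ¬T̄(∉) Ψ`. -/
def setR (α : (dualFunctor T).obj (Lang T At)) :
    Set ((dualFunctor T).obj (lowFunctor.obj (Lang T At))) :=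
  {Ψ | Ψ ∈ Set.range ((dualFunctor T).map (lowFunctor.map (incl (base (dualFunctor T) α)))) ∧
    ¬ lift T (Y := PartOrd.dual.obj (Lang T At)) (X := PartOrd.dual.obj (lowFunctor.obj (Lang T At)))
      (fun a ψ => ¬ (OrderDual.ofDual a ∈ (OrderDual.ofDual ψ : FinLow (Lang T At))))
      (OrderDual.ofDual α) (OrderDual.ofDual Ψ)}

/-- The collection `L_β` of all `Φ ∈ T^∂ U_ω base(β)` with `Φ ¬T̄(∌) β`. -/
def setL (β : (dualFunctor T).obj (Lang T At)) :
    Set ((dualFunctor T).obj (upFunctor.obj (Lang T At))) :=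
  {Φ | Φ ∈ Set.range ((dualFunctor T).map (upFunctor.map (incl (base (dualFunctor T) β)))) ∧
    ¬ lift T (Y := PartOrd.dual.obj (upFunctor.obj (Lang T At))) (X := PartOrd.dual.obj (Lang T At))
      (fun φ b => ¬ (OrderDual.ofDual b ∈ (OrderDual.ofDual φ : FinUp (Lang T At))))
      (OrderDual.ofDual Φ) (OrderDual.ofDual β)}

/-- The poset `U_ω X × L_ω X`. -/
abbrev upLow (X : PartOrd.{u}) : PartOrd.{u} := PartOrd.of (FinUp X × FinLow X)

/-- The projection `p₀`. -/
def projUp (X : PartOrd.{u}) : upLow X ⟶ upFunctor.obj X :=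
  PartOrd.ofHom ⟨Prod.fst, monotone_fst⟩

/-- The projection `p₁`. -/
def projLow (X : PartOrd.{u}) : upLow X ⟶ lowFunctor.obj X :=
  PartOrd.ofHom ⟨Prod.snd, monotone_snd⟩

/-- The inclusion `U_ω V × L_ω W ⟶ U_ω X × L_ω X` for subposets `V`, `W` of `X`. -/
def inclUpLow {X : PartOrd.{u}} (V W : Set X) :
    PartOrd.of (FinUp V × FinLow W) ⟶ upLow X :=
  PartOrd.ofHom ⟨Prod.map (FinUp.map (incl V).hom) (FinLow.map (incl W).hom),
    (FinUp.map (incl V).hom).monotone.prodMap (FinLow.map (incl W).hom).monotone⟩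

/-- The redistributions of `(A, B)`: the elements `Φ` of `T^∂ (U_ω base(A) × L_ω base(B))` with
`(T^∂ p₀) Φ T̄^∂(∋) α` for all `α ∈ A` and `β T̄^∂(∈) (T^∂ p₁) Φ` for all `β ∈ B`. -/
def redistributions (A : FinUp ((dualFunctor T).obj (Lang T At)))
    (B : FinLow ((dualFunctor T).obj (Lang T At))) :
    Set ((dualFunctor T).obj (upLow (Lang T At))) :=
  {Φ | Φ ∈ Set.range ((dualFunctor T).map
      (inclUpLow (base (dualFunctor T ⋙ upFunctor) A) (base (dualFunctor T ⋙ lowFunctor) B))) ∧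
    (∀ α ∈ A, lift (dualFunctor T) (Y := upFunctor.obj (Lang T At)) (X := Lang T At)
      (fun (φ : FinUp (Lang T At)) a => a ∈ φ) ((dualFunctor T).map (projUp _) Φ) α) ∧
    (∀ β ∈ B, lift (dualFunctor T) (Y := Lang T At) (X := lowFunctor.obj (Lang T At))
      (fun b (ψ : FinLow (Lang T At)) => b ∈ ψ) β ((dualFunctor T).map (projLow _) Φ))}

/-- `Provable T At φ ψ`: the sequent `φ ⇒ ψ` has a (well-founded, possibly infinitely branching)
proof. Here `{a}` is the upperset, or lowerset, generated by `a`, and a comma is a union. -/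
inductive Provable [PreservesFilteredColimits T] :
    FinUp (Lang T At) → FinLow (Lang T At) → Prop
  | ax (a b : Lang T At) (h : a ≤ b) : Provable {a} {b}
  | weakR (φ : FinUp (Lang T At)) (ξ ψ : FinLow (Lang T At)) (h : Provable φ ψ) :
      Provable φ (ξ ∪ ψ)
  | weakL (φ ξ : FinUp (Lang T At)) (ψ : FinLow (Lang T At)) (h : Provable φ ψ) :
      Provable (φ ∪ ξ) ψ
  | conjR (φ ξ : FinUp (Lang T At)) (ψ : FinLow (Lang T At))
      (h : ∀ a ∈ ξ, Provable φ ({a} ∪ ψ)) : Provable φ ({conj T At ξ} ∪ ψ)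
  | conjL (φ ξ : FinUp (Lang T At)) (ψ : FinLow (Lang T At)) (h : Provable (φ ∪ ξ) ψ) :
      Provable (φ ∪ {conj T At ξ}) ψ
  | disjR (φ : FinUp (Lang T At)) (ψ ξ : FinLow (Lang T At)) (h : Provable φ (ψ ∪ ξ)) :
      Provable φ (ψ ∪ {disj T At ξ})
  | disjL (φ : FinUp (Lang T At)) (ψ ξ : FinLow (Lang T At))
      (h : ∀ a ∈ ξ, Provable (φ ∪ {a}) ψ) : Provable (φ ∪ {disj T At ξ}) ψ
  | nablaR (φ : FinUp (Lang T At)) (ψ : FinLow (Lang T At))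
      (α : (dualFunctor T).obj (Lang T At))
      (h : ∀ Ψ ∈ setR T At α,
        Provable φ ({delta T At ((dualFunctor T).map (disj T At) Ψ)} ∪ ψ)) :
      Provable φ ({nabla T At α} ∪ ψ)
  | deltaL (φ : FinUp (Lang T At)) (ψ : FinLow (Lang T At))
      (β : (dualFunctor T).obj (Lang T At))
      (h : ∀ Φ ∈ setL T At β,
        Provable (φ ∪ {nabla T At ((dualFunctor T).map (conj T At) Φ)}) ψ) :
      Provable (φ ∪ {delta T At β}) ψ
  | nablaDelta (A : FinUp ((dualFunctor T).obj (Lang T At)))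
      (B : FinLow ((dualFunctor T).obj (Lang T At)))
      (z : ∀ Φ ∈ redistributions T At A B, upLow (Lang T At))
      (hz : ∀ (Φ) (hΦ : Φ ∈ redistributions T At A B), z Φ hΦ ∈ base (dualFunctor T) Φ)
      (h : ∀ (Φ) (hΦ : Φ ∈ redistributions T At A B), Provable (z Φ hΦ).1 (z Φ hΦ).2) :
      Provable (FinUp.map (nabla T At).hom A) (FinLow.map (delta T At).hom B)

end Calculus

end MossPos

/-! Call a state a refutation of φ ⇒ ψ if all of φ holds there and all of ψ fails. A sequent is
valid iff it has no refutation (`valid_iff`), and both directions are statements about transporting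
refutations.

Soundness (`Provable.not_refutes`): a refutation of the conclusion of a rule yields a refutation of
one of its premises. For the modal rules, let θ send a state to the finite sets of relevant formulas
that hold, respectively fail, in it; these sets are finite because bases are. At a state x of a
coalgebra c, the element (Tθ)(c x) provides the member of L_β needed for Δ-l, the member of R_α
needed for ∇-r, and the redistribution needed for ∇Δ. In the last case the base of the
redistribution lies in the image of θ, so every sequent chosen from that base is refuted at some
state.

Completeness (`provable_of_valid`) is proved by contraposition. A refutation of any single premise
of Δ-l or ∇-r also refutes the conclusion (`sat_delta_of_setL`, `not_sat_nabla_of_setR`), and these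
rules do not raise modal depth, because L_β and R_α only involve formulas from a base. Hence an
unprovable sequent of depth at most n reduces to an unprovable literal sequent of depth at most n
(atoms on both sides, ∇ only on the left, Δ only on the right), every refutation of which refutes
the original (`exists_reduces`). Read contrapositively, the rule ∇Δ gives for an unprovable literal
sequent a redistribution whose base consists of unprovable sequents, of depth one less, which reduce
to literal sequents again. The canonical model has the unprovable literal sequents, graded by depth,
as a discrete poset of states; its coalgebra structure pushes the redistributions along a choice of
reductions. By induction on depth each state refutes itself (`exists_canonicalModel`).

Preservation of exact squares supplies the calculus of relation liftings (`lift_restrict`,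
`lift_comp`) and preservation of surjections. Finitarity gives finite supports, and preservation of
intersections makes supports closed under intersection; together they give finite least supports
(`base_spec`). -/

namespace MossPos

/-! ### Generators of finitely generated uppersets and lowersets -/

namespace FinUp

variable {X : Type u} [PartialOrder X]

theorem mem_union {U V : FinUp X} {a : X} : a ∈ U ∪ V ↔ a ∈ U ∨ a ∈ V :=
  UpperSet.mem_inf_iff

theorem mem_singleton {a b : X} : b ∈ ({a} : FinUp X) ↔ a ≤ b := by
  change b ∈ upperClosure {a} ↔ _
  simp

/-- The upperset generated by a finite set. -/
def closure (s : Set X) (hs : s.Finite) : FinUp X := ⟨upperClosure s, s, hs, rfl⟩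

theorem mem_closure {s : Set X} {hs : s.Finite} {b : X} : b ∈ closure s hs ↔ ∃ a ∈ s, a ≤ b :=
  mem_upperClosure

theorem exists_closure (U : FinUp X) : ∃ s hs, U = closure s hs := by
  obtain ⟨s, hs, h⟩ := U.2
  exact ⟨s, hs, Subtype.ext h⟩

/-- An element minimal among the finitely many generators is minimal in the whole upperset. Minimal
elements belong to every generating set, which is what makes supports for `upFunctor` composites
intersect well. -/
theorem exists_minimal_le {U : FinUp X} {a : X} (ha : a ∈ U) :
    ∃ b ∈ U, b ≤ a ∧ ∀ c ∈ U, c ≤ b → c = b := by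
  obtain ⟨s, hs, rfl⟩ := U.exists_closure
  obtain ⟨a', ha', h⟩ := mem_closure.1 ha
  obtain ⟨b, hb, hmin⟩ := hs.exists_le_minimal ha'
  refine ⟨b, mem_closure.2 ⟨b, hmin.1, le_rfl⟩, hb.trans h, fun c hc hcb => le_antisymm hcb ?_⟩
  obtain ⟨d, hd, hdc⟩ := mem_closure.1 hc
  exact (hmin.2 hd (hdc.trans hcb)).trans hdc

/-- `U` is generated by elements of `K`. -/
def GenBy (K : Set X) (U : FinUp X) : Prop := ∀ a ∈ U, ∃ b ∈ U, b ∈ K ∧ b ≤ a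

theorem GenBy.mono {K K' : Set X} (h : K ⊆ K') {U : FinUp X} (hU : GenBy K U) : GenBy K' U :=
  fun a ha =>
    let ⟨b, hb, hK, hba⟩ := hU a ha
    ⟨b, hb, h hK, hba⟩

/-- Replacing each of finitely many generators by an element of `K` below it, still in `U`, keeps
the generated upperset. -/
theorem GenBy.exists_closure {K : Set X} {U : FinUp X} (h : GenBy K U) :
    ∃ s hs, s ⊆ K ∧ U = closure s hs := by
  obtain ⟨s, hs, hU⟩ := U.exists_closure
  choose! f hf using h
  have hsU : ∀ a ∈ s, a ∈ U := fun a ha => hU ▸ mem_closure.2 ⟨a, ha, le_rfl⟩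
  refine ⟨f '' s, hs.image f, ?_, ext fun a => ?_⟩
  · rintro _ ⟨a, ha, rfl⟩
    exact (hf a (hsU a ha)).2.1
  · constructor
    · intro ha
      rw [hU] at ha
      obtain ⟨b, hb, hba⟩ := mem_closure.1 ha
      exact mem_closure.2 ⟨_, ⟨b, hb, rfl⟩, (hf b (hsU b hb)).2.2.trans hba⟩
    · intro ha
      obtain ⟨_, ⟨b, hb, rfl⟩, hba⟩ := mem_closure.1 ha
      exact mem_of_le hba (hf b (hsU b hb)).1

theorem genBy_closure {K s : Set X} {hs : s.Finite} (h : s ⊆ K) : GenBy K (closure s hs) := by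
  intro a ha
  obtain ⟨b, hb, hba⟩ := mem_closure.1 ha
  exact ⟨b, mem_closure.2 ⟨b, hb, le_rfl⟩, h hb, hba⟩

theorem GenBy.union {K : Set X} {U V : FinUp X} (hU : GenBy K U) (hV : GenBy K V) :
    GenBy K (U ∪ V) := by
  intro a ha
  rcases mem_union.1 ha with ha | ha
  · obtain ⟨b, hb, h⟩ := hU a ha
    exact ⟨b, mem_union.2 (Or.inl hb), h⟩
  · obtain ⟨b, hb, h⟩ := hV a ha
    exact ⟨b, mem_union.2 (Or.inr hb), h⟩

theorem genBy_singleton {K : Set X} {a : X} (ha : a ∈ K) : GenBy K {a} :=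
  fun _ hb => ⟨a, mem_singleton.2 le_rfl, ha, mem_singleton.1 hb⟩

/-- Turns "supported on a subposet", for a functor followed by `upFunctor`, into a condition on
generators: finitely many generators in the range of `f` can be lifted along `f`. -/
theorem genBy_range_iff {Y : Type u} [PartialOrder Y] {f : Y →o X} {U : FinUp X} :
    GenBy (Set.range f) U ↔ U ∈ Set.range (map f) := by
  constructor
  · intro h
    obtain ⟨s, hs, hsf, rfl⟩ := h.exists_closure
    obtain ⟨t, ht, rfl⟩ : ∃ t : Set Y, t.Finite ∧ f '' t = s := by
      choose g hg using fun a : s => hsf a.2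
      have := hs.to_subtype
      refine ⟨Set.range g, Set.finite_range g, ?_⟩
      rw [← Set.range_comp, (funext hg : f ∘ g = _), Subtype.range_coe]
    refine ⟨closure t ht, ext fun a => mem_map.trans ?_⟩
    constructor
    · rintro ⟨b, hb, hba⟩
      obtain ⟨c, hc, hcb⟩ := mem_closure.1 hb
      exact mem_closure.2 ⟨f c, ⟨c, hc, rfl⟩, (f.monotone hcb).trans hba⟩
    · intro ha
      obtain ⟨_, ⟨b, hb, rfl⟩, hba⟩ := mem_closure.1 ha
      exact ⟨b, mem_closure.2 ⟨b, hb, le_rfl⟩, hba⟩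
  · rintro ⟨V, rfl⟩ a ha
    obtain ⟨b, hb, hba⟩ := mem_map.1 ha
    exact ⟨f b, mem_map.2 ⟨b, hb, le_rfl⟩, ⟨b, rfl⟩, hba⟩

end FinUp

namespace FinLow

variable {X : Type u} [PartialOrder X]

theorem mem_union {U V : FinLow X} {a : X} : a ∈ U ∪ V ↔ a ∈ U ∨ a ∈ V :=
  LowerSet.mem_sup_iff

theorem mem_singleton {a b : X} : b ∈ ({a} : FinLow X) ↔ b ≤ a := by
  change b ∈ lowerClosure {a} ↔ _
  simp

/-- The lowerset generated by a finite set. -/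
def closure (s : Set X) (hs : s.Finite) : FinLow X := ⟨lowerClosure s, s, hs, rfl⟩

theorem mem_closure {s : Set X} {hs : s.Finite} {b : X} : b ∈ closure s hs ↔ ∃ a ∈ s, b ≤ a :=
  mem_lowerClosure

/-- Lowersets are uppersets of the dual poset. -/
def equivDual : FinLow X ≃ FinUp Xᵒᵈ where
  toFun U := ⟨⟨{a | OrderDual.ofDual a ∈ U}, fun _ _ h ha => U.1.lower h ha⟩, by
    obtain ⟨s, hs, h⟩ := U.2
    exact ⟨s, hs, SetLike.coe_injective (congrArg (fun V : LowerSet X => V.carrier) h)⟩⟩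
  invFun U := ⟨⟨{a | OrderDual.toDual a ∈ U}, fun _ _ h ha => U.1.upper h ha⟩, by
    obtain ⟨s, hs, h⟩ := U.2
    exact ⟨s, hs, SetLike.coe_injective (congrArg (fun V : UpperSet Xᵒᵈ => V.carrier) h)⟩⟩
  left_inv _ := ext fun _ => Iff.rfl
  right_inv _ := FinUp.ext fun _ => Iff.rfl

theorem exists_maximal_le {U : FinLow X} {a : X} (ha : a ∈ U) :
    ∃ b ∈ U, a ≤ b ∧ ∀ c ∈ U, b ≤ c → c = b :=
  FinUp.exists_minimal_le (U := equivDual U) (a := OrderDual.toDual a) ha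

/-- `U` is generated by elements of `K`. -/
def GenBy (K : Set X) (U : FinLow X) : Prop := ∀ a ∈ U, ∃ b ∈ U, b ∈ K ∧ a ≤ b

theorem GenBy.mono {K K' : Set X} (h : K ⊆ K') {U : FinLow X} (hU : GenBy K U) : GenBy K' U :=
  fun a ha =>
    let ⟨b, hb, hK, hba⟩ := hU a ha
    ⟨b, hb, h hK, hba⟩

theorem GenBy.exists_closure {K : Set X} {U : FinLow X} (h : GenBy K U) :
    ∃ s hs, s ⊆ K ∧ U = closure s hs := by
  obtain ⟨s, hs, hK, h⟩ := FinUp.GenBy.exists_closure (X := Xᵒᵈ) (K := K) (U := equivDual U) h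
  exact ⟨s, hs, hK, equivDual.injective h⟩

theorem genBy_closure {K s : Set X} {hs : s.Finite} (h : s ⊆ K) : GenBy K (closure s hs) :=
  FinUp.genBy_closure (X := Xᵒᵈ) (hs := hs) h

theorem GenBy.union {K : Set X} {U V : FinLow X} (hU : GenBy K U) (hV : GenBy K V) :
    GenBy K (U ∪ V) :=
  FinUp.GenBy.union (X := Xᵒᵈ) (U := equivDual U) (V := equivDual V) hU hV

theorem genBy_singleton {K : Set X} {a : X} (ha : a ∈ K) : GenBy K {a} :=
  fun _ hb => ⟨a, mem_singleton.2 le_rfl, ha, mem_singleton.1 hb⟩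

theorem equivDual_map {Y : Type u} [PartialOrder Y] (f : Y →o X) (U : FinLow Y) :
    equivDual (map f U) = FinUp.map f.dual (equivDual U) :=
  FinUp.ext fun a =>
    ⟨fun h => FinUp.mem_map.2 ((mem_map (f := f) (U := U) (y := OrderDual.ofDual a)).1 h),
      fun h => (mem_map (f := f) (U := U) (y := OrderDual.ofDual a)).2 (FinUp.mem_map.1 h)⟩

theorem genBy_range_iff {Y : Type u} [PartialOrder Y] {f : Y →o X} {U : FinLow X} :
    GenBy (Set.range f) U ↔ U ∈ Set.range (map f) := by
  refine (FinUp.genBy_range_iff (X := Xᵒᵈ) (f := f.dual) (U := equivDual U)).trans ?_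
  constructor
  · rintro ⟨V, hV⟩
    obtain ⟨V, rfl⟩ := equivDual.surjective V
    exact ⟨V, equivDual.injective ((equivDual_map f V).trans hV)⟩
  · rintro ⟨V, rfl⟩
    exact ⟨_, (equivDual_map f V).symm⟩

end FinLow

/-! ### Relation lifting -/

section Lifting

variable {G T : PartOrd.{u} ⥤ PartOrd.{u}}

/-- The half of `lift_restrict` that needs neither exactness nor monotonicity of the relation: the
graph of `R'` maps into the graph of `R`. -/
theorem lift_map {A B Y X : PartOrd.{u}} {R : Y → X → Prop} {R' : B → A → Prop} (f : B ⟶ Y)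
    (g : A ⟶ X) (h : ∀ b a, R' b a → R (f b) (g a)) {β : G.obj B} {α : G.obj A}
    (hl : lift G R' β α) : lift G R (G.map f β) (G.map g α) := by
  obtain ⟨w, h0, h1⟩ := hl
  let k : graph R' ⟶ graph R := PartOrd.ofHom
    ⟨fun p => ⟨(f p.1.1, g p.1.2), h _ _ p.2⟩,
      fun p q h => ⟨f.hom.monotone h.1, g.hom.monotone h.2⟩⟩
  refine ⟨G.map k w, ?_, ?_⟩
  · refine ((G.map f).hom.monotone h0).trans_eq ?_
    exact (map_apply_comp G _ _ w).trans (map_apply_comp G k (graphFst R) w).symm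
  · refine le_of_eq_of_le ?_ ((G.map g).hom.monotone h1)
    exact (map_apply_comp G k (graphSnd R) w).trans (map_apply_comp G (graphSnd R') g w).symm

theorem lift_imp {Y X : PartOrd.{u}} {R R' : Y → X → Prop} (h : ∀ b a, R' b a → R b a)
    {β : G.obj Y} {α : G.obj X} (hl : lift G R' β α) : lift G R β α := by
  have := lift_map (R := R) (𝟙 Y) (𝟙 X) h hl
  rwa [G.map_id, G.map_id] at this

/-- The span factors through the graph of `R`. This establishes a modal formula at a state x by
applying T to maps defined on all states and evaluating at c x. -/
theorem lift_span {Z Y X : PartOrd.{u}} {R : Y → X → Prop} (f : Z ⟶ Y) (g : Z ⟶ X)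
    (h : ∀ z, R (f z) (g z)) (w : G.obj Z) : lift G R (G.map f w) (G.map g w) := by
  let k : Z ⟶ graph R := PartOrd.ofHom
    ⟨fun z => ⟨(f z, g z), h z⟩, fun p q h => ⟨f.hom.monotone h, g.hom.monotone h⟩⟩
  exact ⟨G.map k w, (map_apply_comp G k (graphFst R) w).ge, (map_apply_comp G k (graphSnd R) w).le⟩

/-- The comma square of the inner legs of the two graphs is exact, so the two witnesses amalgamate
over it; an element of that comma object is a composable pair up to y ≤ y', hence the form of the
hypothesis `h`. -/
theorem lift_comp (hG : PreservesExactSquares G) {Z Y X : PartOrd.{u}} {R : Z → Y → Prop}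
    {S : Y → X → Prop} {Q : Z → X → Prop} (h : ∀ z y y' x, R z y → y ≤ y' → S y' x → Q z x)
    {γ : G.obj Z} {β : G.obj Y} {α : G.obj X} (h1 : lift G R γ β) (h2 : lift G S β α) :
    lift G Q γ α := by
  obtain ⟨w1, h0, h1⟩ := h1
  obtain ⟨w2, h2, h3⟩ := h2
  obtain ⟨w, h4, h5⟩ := exists_of_comma hG (graphSnd R) (graphFst S) w1 w2 (h1.trans h2)
  let k : (graph fun e e' => graphSnd R e ≤ graphFst S e') ⟶ graph Q := PartOrd.ofHom
    ⟨fun p => ⟨(p.1.1.1.1, p.1.2.1.2), h _ _ _ _ p.1.1.2 p.2 p.1.2.2⟩,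
      fun p q h => ⟨h.1.1, h.2.2⟩⟩
  refine ⟨G.map k w, ?_, ?_⟩
  · refine h0.trans (((G.map (graphFst R)).hom.monotone h4).trans_eq ?_)
    exact (map_apply_comp G _ _ w).trans (map_apply_comp G k (graphFst Q) w).symm
  · refine le_of_eq_of_le ?_ (((G.map (graphSnd S)).hom.monotone h5).trans h3)
    exact (map_apply_comp G k (graphSnd Q) w).trans (map_apply_comp G (graphSnd fun e e' => graphSnd R e ≤ graphFst S e') (graphSnd S) w).symm

/-- The opposite of the graph of `R` is the graph of the converse relation between the opposite
posets. This allows all later arguments to use liftings along `T` alone. -/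
theorem lift_dual {Y X : PartOrd.{u}} {R : Y → X → Prop} {β : (dualFunctor T).obj Y}
    {α : (dualFunctor T).obj X} :
    lift (dualFunctor T) R β α ↔ lift T (Y := PartOrd.dual.obj X) (X := PartOrd.dual.obj Y)
      (fun x y => R (OrderDual.ofDual y) (OrderDual.ofDual x))
      (OrderDual.ofDual α) (OrderDual.ofDual β) := by
  let k : PartOrd.dual.obj (graph R) ⟶ graph (Y := PartOrd.dual.obj X) (X := PartOrd.dual.obj Y)
      (fun x y => R (OrderDual.ofDual y) (OrderDual.ofDual x)) := PartOrd.ofHom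
    ⟨fun p => ⟨(p.1.2, p.1.1), p.2⟩, fun p q h => ⟨h.2, h.1⟩⟩
  let l : graph (Y := PartOrd.dual.obj X) (X := PartOrd.dual.obj Y)
      (fun x y => R (OrderDual.ofDual y) (OrderDual.ofDual x)) ⟶ PartOrd.dual.obj (graph R) :=
    PartOrd.ofHom ⟨fun p => OrderDual.toDual ⟨(p.1.2, p.1.1), p.2⟩, fun p q h => ⟨h.2, h.1⟩⟩
  constructor
  · rintro ⟨w, h0, h1⟩
    exact ⟨T.map k w, le_of_le_of_eq h1 (map_apply_comp T k (graphFst _) w).symm,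
      le_of_eq_of_le (map_apply_comp T k (graphSnd _) w) h0⟩
  · rintro ⟨w, h0, h1⟩
    refine ⟨OrderDual.toDual (T.map l w), ?_, ?_⟩
    · change T.map (PartOrd.dual.map (graphFst R)) (T.map l w) ≤ OrderDual.ofDual β
      exact le_of_eq_of_le (map_apply_comp T l (PartOrd.dual.map (graphFst R)) w) h1
    · change (OrderDual.ofDual α : T.obj (PartOrd.dual.obj X)) ≤ T.map (PartOrd.dual.map (graphSnd R)) (T.map l w)
      exact le_of_le_of_eq h0 (map_apply_comp T l (PartOrd.dual.map (graphSnd R)) w).symm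

/-- Surjectivity of `e` makes the square with both projections `e` and both other sides the identity
exact. Its image under `T` gives y ≤ (Te)w ≤ y. -/
theorem PreservesExactSquares.surjective (hT : PreservesExactSquares T) {X Y : PartOrd.{u}}
    (e : X ⟶ Y) (he : Function.Surjective e) : Function.Surjective (T.map e) := by
  have h : IsExactSquare e e (𝟙 Y) (𝟙 Y) := by
    refine ⟨fun w => le_rfl, fun a b hab => ?_⟩
    obtain ⟨x, rfl⟩ := he a
    exact ⟨x, le_rfl, hab⟩
  intro y
  obtain ⟨w, h1, h2⟩ := (hT _ _ _ _ h).2 y y le_rfl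
  exact ⟨w, le_antisymm h2 h1⟩

end Lifting

/-! ### Bases -/

section Base

variable {G T : PartOrd.{u} ⥤ PartOrd.{u}}

theorem range_subset_of_fac {X Y Z : PartOrd.{u}} (f : Y ⟶ X) (g : Z ⟶ X) (k : Y ⟶ Z)
    (h : k ≫ g = f) : Set.range (G.map f) ⊆ Set.range (G.map g) := by
  rintro _ ⟨a, rfl⟩
  exact ⟨G.map k a, by rw [map_apply_comp, h]⟩

theorem range_incl_mono {X : PartOrd.{u}} {S S' : Set X} (h : S ⊆ S') :
    Set.range (G.map (incl S)) ⊆ Set.range (G.map (incl S')) :=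
  range_subset_of_fac _ _ (PartOrd.ofHom ⟨Set.inclusion h, fun _ _ h => h⟩) rfl

theorem range_subset_range_incl {X Y : PartOrd.{u}} (f : Y ⟶ X) :
    Set.range (G.map f) ⊆ Set.range (G.map (incl (Set.range f))) :=
  range_subset_of_fac _ _ (PartOrd.ofHom ⟨fun y => ⟨f y, y, rfl⟩, fun _ _ h => f.hom.monotone h⟩) rfl

theorem base_subset {X : PartOrd.{u}} {α : G.obj X} {S : Set X}
    (h : α ∈ Set.range (G.map (incl S))) : base G α ⊆ S :=
  Set.sInter_subset_of_mem h

theorem base_subset_range {X Y : PartOrd.{u}} {α : G.obj X} {f : Y ⟶ X}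
    (h : α ∈ Set.range (G.map f)) : base G α ⊆ Set.range f :=
  base_subset (range_subset_range_incl f h)

variable (G) in
/-- Every element of `G X` has a finite support. -/
def HasFiniteSupports : Prop :=
  ∀ ⦃X : PartOrd.{u}⦄ (α : G.obj X), ∃ S : Set X, S.Finite ∧ α ∈ Set.range (G.map (incl S))

variable (G) in
/-- Supports are closed under binary intersections. -/
def SupportsInter : Prop :=
  ∀ ⦃X : PartOrd.{u}⦄ (α : G.obj X) (S S' : Set X), α ∈ Set.range (G.map (incl S)) →
    α ∈ Set.range (G.map (incl S')) → α ∈ Set.range (G.map (incl (S ∩ S')))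

/-- Inside a finite support there are only finitely many supports, so a minimal one exists; closure
under intersections makes it least among all supports, hence equal to the base. -/
theorem base_spec (hf : HasFiniteSupports G) (hi : SupportsInter G) {X : PartOrd.{u}}
    (α : G.obj X) : (base G α).Finite ∧ α ∈ Set.range (G.map (incl (base G α))) := by
  obtain ⟨S₀, hS₀, h₀⟩ := hf α
  have hfin : {S | S ⊆ S₀ ∧ α ∈ Set.range (G.map (incl S))}.Finite :=
    hS₀.finite_subsets.subset fun S hS => hS.1
  obtain ⟨S, -, hS⟩ := hfin.exists_le_minimal ⟨subset_rfl, h₀⟩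
  have h : base G α = S := by
    refine (base_subset hS.1.2).antisymm (Set.subset_sInter fun S' hS' => ?_)
    exact (hS.2 ⟨Set.inter_subset_left.trans hS.1.1, hi α S S' hS.1.2 hS'⟩
      Set.inter_subset_left).trans Set.inter_subset_right
  rw [h]
  exact ⟨hS₀.subset hS.1.1, hS.1.2⟩

/-- The diagram of finite subsets of a poset. -/
def finsetDiagram (X : PartOrd.{u}) : Finset X ⥤ PartOrd.{u} where
  obj s := PartOrd.of (s : Set X)
  map h := PartOrd.ofHom ⟨Set.inclusion (leOfHom h), fun _ _ h => h⟩

/-- A poset as the cocone over its finite subsets. -/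
def finsetCocone (X : PartOrd.{u}) : Cocone (finsetDiagram X) where
  pt := X
  ι := { app := fun s => incl (s : Set X) }

/-- A poset is the colimit of its finite subsets. -/
def isColimitFinsetCocone (X : PartOrd.{u}) : IsColimit (finsetCocone X) := by
  classical
  -- A cocone is determined by its values on singletons; two-element subsets then give monotonicity
  -- of the induced map.
  have key : ∀ (c : Cocone (finsetDiagram X)) (s : Finset X) (x : X) (hx : x ∈ s),
      c.ι.app s ⟨x, hx⟩ = c.ι.app {x} ⟨x, Finset.mem_singleton_self x⟩ := fun c s x hx =>
    (ConcreteCategory.congr_hom (c.w (homOfLE (Finset.singleton_subset_iff.2 hx)))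
      ⟨x, Finset.mem_singleton_self x⟩)
  exact
    { desc := fun c => PartOrd.ofHom
        ⟨fun x => c.ι.app {x} ⟨x, Finset.mem_singleton_self x⟩, fun x y h =>
          le_of_eq_of_le (key c {x, y} x (by simp)).symm
            (le_of_le_of_eq ((c.ι.app {x, y}).hom.monotone h) (key c {x, y} y (by simp)))⟩
      fac := fun c s => by
        ext x
        exact (key c s x.1 x.2).symm
      uniq := fun c m hm => by
        ext x
        exact ConcreteCategory.congr_hom (hm {x}) ⟨x, Finset.mem_singleton_self x⟩ }

/-- The union of the images of the injections carries a cocone, so by the universal property the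
identity of the colimit factors through its inclusion. -/
theorem jointly_surjective {J : Type u} [SmallCategory J] {D : J ⥤ PartOrd.{u}} {c : Cocone D}
    (hc : IsColimit c) (x : c.pt) : ∃ j a, c.ι.app j a = x := by
  let I : Set c.pt := {x | ∃ j a, c.ι.app j a = x}
  let c' : Cocone D :=
    { pt := PartOrd.of I
      ι :=
        { app := fun j => PartOrd.ofHom
            ⟨fun a => ⟨c.ι.app j a, j, a, rfl⟩, fun a b h => (c.ι.app j).hom.monotone h⟩
          naturality := fun i j f => by
            ext a
            exact Subtype.ext (ConcreteCategory.congr_hom (c.w f) a) } }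
  have h : hc.desc c' ≫ incl I = 𝟙 c.pt := by
    refine hc.hom_ext fun j => ?_
    rw [← Category.assoc, hc.fac, Category.comp_id]
    rfl
  have h' : incl I (hc.desc c' x) = x := ConcreteCategory.congr_hom h x
  rw [← h']
  exact (hc.desc c' x).2

/-- A poset is the filtered colimit of its finite subposets, and `G` preserves it. -/
theorem hasFiniteSupports [PreservesFilteredColimits G] : HasFiniteSupports G := by
  intro X α
  classical
  obtain ⟨s, a, h⟩ := jointly_surjective (isColimitOfPreserves G (isColimitFinsetCocone X)) α
  exact ⟨s, s.finite_toSet, a, h⟩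

theorem isPullback_incl_inter {X : PartOrd.{u}} (S S' : Set X) :
    IsPullback (PartOrd.ofHom ⟨Set.inclusion Set.inter_subset_left, fun _ _ h => h⟩ :
        PartOrd.of ↥(S ∩ S') ⟶ PartOrd.of S)
      (PartOrd.ofHom ⟨Set.inclusion Set.inter_subset_right, fun _ _ h => h⟩ :
        PartOrd.of ↥(S ∩ S') ⟶ PartOrd.of S') (incl S) (incl S') where
  w := rfl
  isLimit' := ⟨PullbackCone.IsLimit.mk (f := incl S) (g := incl S') rfl
    (fun s => PartOrd.ofHom (X := s.pt) (Y := ↥(S ∩ S')) ⟨fun x => ⟨(s.fst x).1, (s.fst x).2, by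
        have h : (s.fst x).1 = (s.snd x).1 := ConcreteCategory.congr_hom s.condition x
        rw [h]
        exact (s.snd x).2⟩,
      fun x y h => s.fst.hom.monotone h⟩)
    (fun s => rfl)
    (fun s => by
      refine PartOrd.ext fun x => Subtype.ext ?_
      exact ConcreteCategory.congr_hom s.condition x)
    (fun s m h _ => by
      refine PartOrd.ext fun x => Subtype.ext ?_
      exact congrArg (fun y : S => y.1) (ConcreteCategory.congr_hom h x))⟩

/-- Elements are maps out of the one-point poset. -/
theorem exists_of_isPullback {P A B X : PartOrd.{u}} {i : P ⟶ A} {j : P ⟶ B} {m : A ⟶ X}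
    {n : B ⟶ X} (h : IsPullback i j m n) {a : A} {b : B} (hab : m a = n b) :
    ∃ p, i p = a ∧ j p = b := by
  let f : PartOrd.of PUnit.{u + 1} ⟶ A := PartOrd.ofHom (OrderHom.const _ a)
  let g : PartOrd.of PUnit.{u + 1} ⟶ B := PartOrd.ofHom (OrderHom.const _ b)
  have hfg : f ≫ m = g ≫ n := by
    ext x
    exact hab
  exact ⟨h.lift f g hfg PUnit.unit, ConcreteCategory.congr_hom (h.lift_fst f g hfg) PUnit.unit,
    ConcreteCategory.congr_hom (h.lift_snd f g hfg) PUnit.unit⟩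

theorem supportsInter (hG : PreservesFiniteIntersections G) : SupportsInter G := by
  rintro X α S S' ⟨a, ha⟩ ⟨b, hb⟩
  obtain ⟨p, hp, -⟩ := exists_of_isPullback (hG _ _ _ _ (fun _ _ h => h) (fun _ _ h => h)
    (isPullback_incl_inter S S')) (ha.trans hb.symm)
  refine ⟨p, ?_⟩
  rw [← ha, ← hp, map_apply_comp]
  rfl

theorem IsEmb.dual {X Y : PartOrd.{u}} {m : X ⟶ Y} (hm : IsEmb m) : IsEmb (PartOrd.dual.map m) :=
  fun (x y : Xᵒᵈ) h => OrderDual.ofDual_le_ofDual.1 (hm (OrderDual.ofDual y) (OrderDual.ofDual x) h)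

theorem PreservesFiniteIntersections.dual (hT : PreservesFiniteIntersections T) :
    PreservesFiniteIntersections (dualFunctor T) := by
  have : PartOrd.dual.{u}.IsEquivalence := PartOrd.dualEquiv.{u}.isEquivalence_functor
  intro P A B X i j m n hm hn h
  exact (hT _ _ _ _ hm.dual hn.dual
    (h.map PartOrd.dual)).map PartOrd.dual

instance [PreservesFilteredColimits T] : PreservesFilteredColimits (dualFunctor T) := by
  have : PartOrd.dual.{u}.IsEquivalence := PartOrd.dualEquiv.{u}.isEquivalence_functor
  unfold dualFunctor
  infer_instance

/-! ### Supports for composites with U_ω and L_ω. -/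

theorem HasFiniteSupports.comp_up (hf : HasFiniteSupports G) :
    HasFiniteSupports (G ⋙ upFunctor) := by
  intro X A
  obtain ⟨s, hs, rfl⟩ := FinUp.exists_closure A
  choose S hS hsup using fun α : G.obj X => hf α
  refine ⟨⋃ α ∈ s, S α, hs.biUnion fun α _ => hS α, ?_⟩
  exact FinUp.genBy_range_iff.1 (FinUp.genBy_closure fun α hα =>
    range_incl_mono (Set.subset_biUnion_of_mem hα) (hsup α))

theorem HasFiniteSupports.comp_low (hf : HasFiniteSupports G) :
    HasFiniteSupports (G ⋙ lowFunctor) := by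
  intro X A
  obtain ⟨s, hs, -, rfl⟩ := FinLow.GenBy.exists_closure (K := Set.univ) (U := A)
    fun a ha => ⟨a, ha, trivial, le_rfl⟩
  choose S hS hsup using fun α : G.obj X => hf α
  refine ⟨⋃ α ∈ s, S α, hs.biUnion fun α _ => hS α, ?_⟩
  exact FinLow.genBy_range_iff.1 (FinLow.genBy_closure fun α hα =>
    range_incl_mono (Set.subset_biUnion_of_mem hα) (hsup α))

/-- Generators supported on `S` and generators supported on `S'` both include every minimal element
of the upperset. So each minimal element has both supports, hence their intersection, and the
minimal elements generate. -/
theorem SupportsInter.comp_up (hi : SupportsInter G) : SupportsInter (G ⋙ upFunctor) := by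
  intro X A S S' h h'
  have h1 := FinUp.genBy_range_iff.2 h
  have h2 := FinUp.genBy_range_iff.2 h'
  refine FinUp.genBy_range_iff.1 fun a ha => ?_
  obtain ⟨b, hb, hba, hmin⟩ := FinUp.exists_minimal_le ha
  obtain ⟨c, hc, hcS, hcb⟩ := h1 b hb
  obtain ⟨d, hd, hdS, hdb⟩ := h2 b hb
  obtain rfl := hmin c hc hcb
  obtain rfl := hmin d hd hdb
  exact ⟨_, hb, hi _ _ _ hcS hdS, hba⟩

theorem SupportsInter.comp_low (hi : SupportsInter G) : SupportsInter (G ⋙ lowFunctor) := by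
  intro X A S S' h h'
  have h1 := FinLow.genBy_range_iff.2 h
  have h2 := FinLow.genBy_range_iff.2 h'
  refine FinLow.genBy_range_iff.1 fun a ha => ?_
  obtain ⟨b, hb, hba, hmin⟩ := FinLow.exists_maximal_le ha
  obtain ⟨c, hc, hcS, hcb⟩ := h1 b hb
  obtain ⟨d, hd, hdS, hdb⟩ := h2 b hb
  obtain rfl := hmin c hc hcb
  obtain rfl := hmin d hd hdb
  exact ⟨_, hb, hi _ _ _ hcS hdS, hba⟩

end Base

/-! ### Local soundness of the modal rules -/

section Soundness

variable {T : PartOrd.{u} ⥤ PartOrd.{u}} {At X : PartOrd.{u}}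

theorem map_dual_eq {Y Z : PartOrd.{u}} {f : Y ⟶ Z} {β' : (dualFunctor T).obj Y}
    {β : (dualFunctor T).obj Z} (h : (dualFunctor T).map f β' = β) :
    T.map (PartOrd.dual.map f) (OrderDual.ofDual β') =
      (OrderDual.ofDual β : T.obj (PartOrd.dual.obj Z)) := h

/-- Puts ∇ in the same form as Δ, as a lifting along `T` evaluated at `c x`. Beyond `lift_dual`,
only the isomorphism of `X` with its double dual has to be removed. -/
theorem liftNabla_iff (c : X ⟶ T.obj X) {W : PartOrd.{u}} (S : X → W → Prop) (x : X)
    (α : (dualFunctor T).obj W) :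
    liftNabla c S x α ↔ lift T (Y := PartOrd.dual.obj W) (X := X)
      (fun a y => S y (OrderDual.ofDual a)) (OrderDual.ofDual α) (c x) := by
  let i := PartOrd.dualEquiv.{u}.unitIso.hom.app X
  let j := PartOrd.dualEquiv.{u}.unitIso.inv.app X
  have e : OrderDual.ofDual (coalgDual c (OrderDual.toDual x)) = T.map i (c x) := rfl
  have hij : T.map j (T.map i (c x)) = c x := by
    rw [map_apply_comp, Iso.hom_inv_id_app, T.map_id]
    rfl
  refine lift_dual.trans ?_
  constructor
  · intro h
    have h1 := lift_map (R := fun (a : PartOrd.dual.obj W) y => S y (OrderDual.ofDual a)) (𝟙 _) j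
      (fun a y h => h) h
    rw [T.map_id] at h1
    exact hij ▸ h1
  · intro h
    have h1 := lift_map (R := fun (a : PartOrd.dual.obj W)
      (y : PartOrd.dual.obj (PartOrd.dual.obj X)) =>
        S (OrderDual.ofDual (OrderDual.ofDual y)) (OrderDual.ofDual a)) (𝟙 _) i
      (fun a y h => h) h
    rw [T.map_id] at h1
    exact h1

theorem sat_nabla_iff [PreservesFilteredColimits T] (hT : PreservesExactSquares T)
    (c : X ⟶ T.obj X) (v : Valuation At X) (x : X) (α : (dualFunctor T).obj (Lang T At)) :
    Sat c v x (nabla T At α) ↔ lift T (Y := PartOrd.dual.obj (Lang T At)) (X := X)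
      (fun a y => Sat c v y (OrderDual.ofDual a)) (OrderDual.ofDual α) (c x) :=
  (sat_nabla hT c v x α).trans (liftNabla_iff c _ x α)

/-- The elements of a finite set that hold in a state. -/
def posTheory (hT : PreservesExactSquares T) (c : X ⟶ T.obj X) (v : Valuation At X)
    {S : Set (Lang T At)} (hS : S.Finite) : X ⟶ PartOrd.dual.obj (PartOrd.of (FinUp S)) :=
  PartOrd.ofHom
    ⟨fun x => OrderDual.toDual ⟨⟨{a | Sat c v x a.1}, fun _ _ hab ha =>
        sat_mono hT c v _ _ _ _ le_rfl hab ha⟩, {a | Sat c v x a.1}, by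
          have := hS.to_subtype
          exact Set.toFinite _, by
          refine SetLike.coe_injective (Set.Subset.antisymm subset_upperClosure fun a ha => ?_)
          obtain ⟨b, hb, hba⟩ := mem_upperClosure.1 ha
          exact sat_mono hT c v _ _ _ _ le_rfl hba hb⟩,
      fun _ _ hxy _ ha => sat_mono hT c v _ _ _ _ hxy le_rfl ha⟩

/-- The elements of a finite set that fail in a state. -/
def negTheory (hT : PreservesExactSquares T) (c : X ⟶ T.obj X) (v : Valuation At X)
    {S : Set (Lang T At)} (hS : S.Finite) : X ⟶ PartOrd.dual.obj (PartOrd.of (FinLow S)) :=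
  PartOrd.ofHom
    ⟨fun x => OrderDual.toDual ⟨⟨{a | ¬ Sat c v x a.1}, fun _ _ hab ha hb =>
        ha (sat_mono hT c v _ _ _ _ le_rfl hab hb)⟩, {a | ¬ Sat c v x a.1}, by
          have := hS.to_subtype
          exact Set.toFinite _, by
          refine SetLike.coe_injective (Set.Subset.antisymm subset_lowerClosure fun a ha => ?_)
          obtain ⟨b, hb, hba⟩ := mem_lowerClosure.1 ha
          exact fun h => hb (sat_mono hT c v _ _ _ _ le_rfl hba h)⟩,
      fun _ _ hxy _ ha h => ha (sat_mono hT c v _ _ _ _ hxy le_rfl h)⟩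

section

variable (hT : PreservesExactSquares T) (c : X ⟶ T.obj X) (v : Valuation At X)
  {S : Set (Lang T At)} (hS : S.Finite)

theorem mem_map_posTheory {x : X} {a : Lang T At} :
    a ∈ FinUp.map (incl S).hom (OrderDual.ofDual (posTheory hT c v hS x)) ↔
      ∃ b ∈ S, Sat c v x b ∧ b ≤ a := by
  refine FinUp.mem_map.trans ⟨?_, ?_⟩
  · rintro ⟨b, hb, hba⟩
    exact ⟨b.1, b.2, hb, hba⟩
  · rintro ⟨b, hbS, hb, hba⟩
    exact ⟨⟨b, hbS⟩, hb, hba⟩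

theorem mem_map_negTheory {x : X} {a : Lang T At} :
    a ∈ FinLow.map (incl S).hom (OrderDual.ofDual (negTheory hT c v hS x)) ↔
      ∃ b ∈ S, ¬ Sat c v x b ∧ a ≤ b := by
  refine FinLow.mem_map.trans ⟨?_, ?_⟩
  · rintro ⟨b, hb, hba⟩
    exact ⟨b.1, b.2, hb, hba⟩
  · rintro ⟨b, hbS, hb, hba⟩
    exact ⟨⟨b, hbS⟩, hb, hba⟩

end

/-! ### The premises of Δ-l and ∇-r compared with their conclusions at a state. -/

variable [PreservesFilteredColimits T]

/-- If Δβ failed, composing the lifted relation "⋀φ holds at y" with the lifted relation "b fails at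
y" would relate Φ to β by the lifting of ∌, which membership in L_β excludes. Used for completeness:
refuting one premise of Δ-l refutes the conclusion. -/
theorem sat_delta_of_setL (hT : PreservesExactSquares T) (c : X ⟶ T.obj X) (v : Valuation At X)
    (x : X) (β : (dualFunctor T).obj (Lang T At)) {Φ} (hΦ : Φ ∈ setL T At β)
    (h : Sat c v x (nabla T At ((dualFunctor T).map (conj T At) Φ))) :
    Sat c v x (delta T At β) := by
  by_contra h'
  refine hΦ.2 ?_
  have h1 := (lift_restrict hT (Y := PartOrd.dual.obj (Lang T At)) (X := X)
    (R := fun a y => Sat c v y (OrderDual.ofDual a))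
    (fun a a' y y' ha hy h => sat_mono hT c v _ _ _ _ hy ha h)
    (PartOrd.dual.map (conj T At)) (𝟙 X)
    (R' := fun a y => Sat c v y (conj T At (OrderDual.ofDual a))) (fun _ _ => Iff.rfl)
    (OrderDual.ofDual Φ) (c x)).2 (by rw [T.map_id]; exact (sat_nabla_iff hT c v x _).1 h)
  refine lift_comp hT ?_ h1 ((sat_delta hT c v x β).1 h')
  intro φ y y' b hy hyy hb hbφ
  exact hb (sat_mono hT c v _ _ _ _ hyy le_rfl ((sat_conj hT c v y _).1 hy _ hbφ))

/-- Dual to `sat_delta_of_setL`: if a holds at y and ⋁ψ fails above y, then a ∉ ψ, so ∇α together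
with the failure of the Δ-formula would give the excluded lifting of ∉. -/
theorem not_sat_nabla_of_setR (hT : PreservesExactSquares T) (c : X ⟶ T.obj X)
    (v : Valuation At X) (x : X) (α : (dualFunctor T).obj (Lang T At)) {Ψ}
    (hΨ : Ψ ∈ setR T At α)
    (h : ¬ Sat c v x (delta T At ((dualFunctor T).map (disj T At) Ψ))) :
    ¬ Sat c v x (nabla T At α) := by
  intro h'
  refine hΨ.2 ?_
  have h1 := (lift_restrict hT (Y := X) (X := PartOrd.dual.obj (Lang T At))
    (R := fun y a => ¬ Sat c v y (OrderDual.ofDual a))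
    (fun y y' a a' hy ha h h' => h (sat_mono hT c v _ _ _ _ hy ha h'))
    (𝟙 X) (PartOrd.dual.map (disj T At))
    (R' := fun y a => ¬ Sat c v y (disj T At (OrderDual.ofDual a))) (fun _ _ => Iff.rfl)
    (c x) (OrderDual.ofDual Ψ)).2 (by rw [T.map_id]; exact (sat_delta hT c v x _).1 h)
  refine lift_comp hT ?_ ((sat_nabla_iff hT c v x α).1 h') h1
  intro a y y' ψ ha hyy hψ haψ
  exact hψ ((sat_disj hT c v y' _).2 ⟨_, haψ, sat_mono hT c v _ _ _ _ hyy le_rfl ha⟩)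

theorem base_dual_spec (hi : PreservesFiniteIntersections T)
    {X : PartOrd.{u}} (α : (dualFunctor T).obj X) : (base (dualFunctor T) α).Finite ∧
      α ∈ Set.range ((dualFunctor T).map (incl (base (dualFunctor T) α))) :=
  base_spec hasFiniteSupports (supportsInter hi.dual) α

/-- Soundness of Δ-l. The witness is the image of `c x` under the map sending a state to the
formulas of the finite set base(β) that hold there. -/
theorem exists_setL_of_sat_delta (hT : PreservesExactSquares T)
    (hi : PreservesFiniteIntersections T) (c : X ⟶ T.obj X) (v : Valuation At X)
    (x : X) (β : (dualFunctor T).obj (Lang T At)) (h : Sat c v x (delta T At β)) :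
    ∃ Φ ∈ setL T At β, Sat c v x (nabla T At ((dualFunctor T).map (conj T At) Φ)) := by
  obtain ⟨hfin, β', hβ⟩ := base_dual_spec hi β
  let θ := posTheory hT c v hfin
  let i := upFunctor.map (incl (base (dualFunctor T) β))
  refine ⟨(dualFunctor T).map i (OrderDual.toDual (T.map θ (c x))), ⟨⟨_, rfl⟩, fun h1 => ?_⟩, ?_⟩
  · refine (sat_delta hT c v x β).2 ?_ h
    -- For b in the base, b is outside the theory of y exactly when b fails at y. Restricting the
    -- lifting of ∌ along the theory map therefore gives the lifting of ⊮ at `c x`, contradicting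
    -- Δβ.
    have h2 := (lift_restrict hT (Y := PartOrd.dual.obj (upFunctor.obj (Lang T At)))
      (X := PartOrd.dual.obj (Lang T At))
      (R := fun φ b => ¬ (OrderDual.ofDual b ∈ (OrderDual.ofDual φ : FinUp (Lang T At))))
      (fun φ φ' b b' hφ hb h h' => h (FinUp.le_iff.1 hφ _ (FinUp.mem_of_le hb h')))
      (θ ≫ PartOrd.dual.map i) (PartOrd.dual.map (incl (base (dualFunctor T) β)))
      (R' := fun y b => ¬ Sat c v y (OrderDual.ofDual b).1) (by
        intro y b
        refine not_congr (Iff.trans ?_ (mem_map_posTheory hT c v hfin).symm)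
        exact ⟨fun h => ⟨_, (OrderDual.ofDual b).2, h, le_rfl⟩,
          fun ⟨_, _, h, hb⟩ => sat_mono hT c v _ _ _ _ le_rfl hb h⟩)
      (c x) (OrderDual.ofDual β')).2 (by
        rw [← map_apply_comp]
        exact lift_mono le_rfl (map_dual_eq hβ).ge h1)
    have h3 := lift_map (R := fun y (a : PartOrd.dual.obj (Lang T At)) =>
      ¬ Sat c v y (OrderDual.ofDual a)) (𝟙 X)
      (PartOrd.dual.map (incl (base (dualFunctor T) β))) (fun _ _ h => h) h2
    rw [T.map_id] at h3
    rw [← hβ]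
    exact h3
  · refine (sat_nabla_iff hT c v x _).2 ?_
    have h1 := lift_span (R := fun (a : PartOrd.dual.obj (Lang T At)) y =>
      Sat c v y (OrderDual.ofDual a))
      (θ ≫ PartOrd.dual.map i ≫ PartOrd.dual.map (conj T At)) (𝟙 X) (by
        intro y
        refine (sat_conj hT c v y _).2 fun a ha => ?_
        obtain ⟨b, -, hb, hba⟩ := (mem_map_posTheory hT c v hfin).1 ha
        exact sat_mono hT c v _ _ _ _ le_rfl hba hb) (c x)
    rw [T.map_id, ← map_apply_comp, ← map_apply_comp] at h1
    exact h1

/-- Soundness of ∇-r, dually: the witness collects the formulas of base(α) that fail, and a formula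
of the base holds exactly when it is outside this set. -/
theorem exists_setR_of_not_sat_nabla (hT : PreservesExactSquares T)
    (hi : PreservesFiniteIntersections T) (c : X ⟶ T.obj X) (v : Valuation At X)
    (x : X) (α : (dualFunctor T).obj (Lang T At)) (h : ¬ Sat c v x (nabla T At α)) :
    ∃ Ψ ∈ setR T At α, ¬ Sat c v x (delta T At ((dualFunctor T).map (disj T At) Ψ)) := by
  obtain ⟨hfin, α', hα⟩ := base_dual_spec hi α
  let θ := negTheory hT c v hfin
  let i := lowFunctor.map (incl (base (dualFunctor T) α))
  refine ⟨(dualFunctor T).map i (OrderDual.toDual (T.map θ (c x))), ⟨⟨_, rfl⟩, fun h1 => ?_⟩, ?_⟩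
  · refine h ((sat_nabla_iff hT c v x α).2 ?_)
    have h2 := (lift_restrict hT (X := PartOrd.dual.obj (lowFunctor.obj (Lang T At)))
      (Y := PartOrd.dual.obj (Lang T At))
      (R := fun a ψ => ¬ (OrderDual.ofDual a ∈ (OrderDual.ofDual ψ : FinLow (Lang T At))))
      (fun a a' ψ ψ' ha hψ h h' => h (FinLow.le_iff.1 hψ _ (FinLow.mem_of_le ha h')))
      (PartOrd.dual.map (incl (base (dualFunctor T) α))) (θ ≫ PartOrd.dual.map i)
      (R' := fun a y => Sat c v y (OrderDual.ofDual a).1) (by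
        intro a y
        refine not_not.symm.trans
          (not_congr (Iff.trans ?_ (mem_map_negTheory hT c v hfin).symm))
        exact ⟨fun h => ⟨_, (OrderDual.ofDual a).2, h, le_rfl⟩,
          fun ⟨_, _, h, hb⟩ h' => h (sat_mono hT c v _ _ _ _ le_rfl hb h')⟩)
      (OrderDual.ofDual α') (c x)).2 (by
        rw [← map_apply_comp]
        exact lift_mono (map_dual_eq hα).le le_rfl h1)
    have h3 := lift_map (R := fun (a : PartOrd.dual.obj (Lang T At)) y =>
      Sat c v y (OrderDual.ofDual a))
      (PartOrd.dual.map (incl (base (dualFunctor T) α))) (𝟙 X) (fun _ _ h => h) h2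
    rw [T.map_id] at h3
    rw [← hα]
    exact h3
  · refine (sat_delta hT c v x _).2 ?_
    have h1 := lift_span (R := fun y (a : PartOrd.dual.obj (Lang T At)) =>
      ¬ Sat c v y (OrderDual.ofDual a)) (𝟙 X)
      (θ ≫ PartOrd.dual.map i ≫ PartOrd.dual.map (disj T At)) (by
        intro y h
        obtain ⟨a, ha, h⟩ := (sat_disj hT c v y _).1 h
        obtain ⟨b, -, hb, hba⟩ := (mem_map_negTheory hT c v hfin).1 ha
        exact hb (sat_mono hT c v _ _ _ _ le_rfl hba h)) (c x)
    rw [T.map_id, ← map_apply_comp, ← map_apply_comp] at h1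
    exact h1

end Soundness

/-! ### Soundness -/

section Soundness

variable {T : PartOrd.{u} ⥤ PartOrd.{u}} {At X : PartOrd.{u}}

/-- All formulas of `φ` hold and all formulas of `ψ` fail in the state `x`. -/
def Refutes (c : X ⟶ T.obj X) (v : Valuation At X) (x : X) (φ : FinUp (Lang T At))
    (ψ : FinLow (Lang T At)) : Prop :=
  (∀ a ∈ φ, Sat c v x a) ∧ ∀ b ∈ ψ, ¬ Sat c v x b

theorem valid_iff (hT : PreservesExactSquares T) (φ : FinUp (Lang T At)) (ψ : FinLow (Lang T At)) :
    Valid T At φ ψ ↔ ∀ (X : PartOrd.{u}) (c : X ⟶ T.obj X) (v : Valuation At X) (x : X),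
      ¬ Refutes c v x φ ψ := by
  refine forall_congr' fun X => forall_congr' fun c => forall_congr' fun v => forall_congr' fun x => ?_
  rw [sat_conj hT, sat_disj hT]
  simp only [Refutes, not_and, not_forall, not_not, exists_prop]

variable [PreservesFilteredColimits T]

theorem base_up_spec (hi : PreservesFiniteIntersections T)
    {X : PartOrd.{u}} (A : FinUp ((dualFunctor T).obj X)) :
    (base (dualFunctor T ⋙ upFunctor) A).Finite ∧
      FinUp.GenBy (Set.range ((dualFunctor T).map (incl (base (dualFunctor T ⋙ upFunctor) A)))) A := by
  have h := base_spec (hasFiniteSupports (G := dualFunctor T)).comp_up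
    (supportsInter hi.dual).comp_up A
  exact ⟨h.1, FinUp.genBy_range_iff.2 h.2⟩

theorem base_low_spec (hi : PreservesFiniteIntersections T)
    {X : PartOrd.{u}} (A : FinLow ((dualFunctor T).obj X)) :
    (base (dualFunctor T ⋙ lowFunctor) A).Finite ∧
      FinLow.GenBy
        (Set.range ((dualFunctor T).map (incl (base (dualFunctor T ⋙ lowFunctor) A)))) A := by
  have h := base_spec (hasFiniteSupports (G := dualFunctor T)).comp_low
    (supportsInter hi.dual).comp_low A
  exact ⟨h.1, FinLow.genBy_range_iff.2 h.2⟩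

/-- The formulas of finite sets that hold, respectively fail, in a state. -/
def theory (hT : PreservesExactSquares T) (c : X ⟶ T.obj X) (v : Valuation At X)
    {V W : Set (Lang T At)} (hV : V.Finite) (hW : W.Finite) :
    X ⟶ PartOrd.dual.obj (PartOrd.of (FinUp V × FinLow W)) :=
  PartOrd.ofHom ⟨fun x => OrderDual.toDual
    (OrderDual.ofDual (posTheory hT c v hV x), OrderDual.ofDual (negTheory hT c v hW x)),
    fun _ _ h => ⟨(posTheory hT c v hV).hom.monotone h, (negTheory hT c v hW).hom.monotone h⟩⟩

/-- Soundness of ∇Δ. The redistribution is the image of `c x` under the map sending a state to the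
formulas of base(A) that hold and those of base(B) that fail; it is supported on the pairs that
states actually realise. -/
theorem exists_redistribution (hT : PreservesExactSquares T)
    (hi : PreservesFiniteIntersections T) (c : X ⟶ T.obj X) (v : Valuation At X) (x : X)
    (A : FinUp ((dualFunctor T).obj (Lang T At))) (B : FinLow ((dualFunctor T).obj (Lang T At)))
    (hA : ∀ α ∈ A, Sat c v x (nabla T At α)) (hB : ∀ β ∈ B, ¬ Sat c v x (delta T At β)) :
    ∃ Φ ∈ redistributions T At A B, ∀ z ∈ base (dualFunctor T) Φ, ∃ y, Refutes c v y z.1 z.2 := by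
  obtain ⟨hV, hgA⟩ := base_up_spec hi A
  obtain ⟨hW, hgB⟩ := base_low_spec hi B
  generalize hVdef : base (dualFunctor T ⋙ upFunctor) A = V at hV hgA
  generalize hWdef : base (dualFunctor T ⋙ lowFunctor) B = W at hW hgB
  let θ := theory hT c v hV hW
  let f := θ ≫ PartOrd.dual.map (inclUpLow V W)
  have hΦ : (dualFunctor T).map (inclUpLow V W) (OrderDual.toDual (T.map θ (c x))) =
      OrderDual.toDual (T.map f (c x)) := map_apply_comp T θ _ (c x)
  refine ⟨OrderDual.toDual (T.map f (c x)), ⟨?_, fun α hα => ?_, fun β hβ => ?_⟩, fun z hz => ?_⟩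
  · rw [hVdef, hWdef]
    exact ⟨_, hΦ⟩
  -- Only generators of `A` are known to be supported on `V`; the lifting is upward closed in α, so
  -- a generator α₀ ≤ α suffices.
  · obtain ⟨α₀, hα₀, ⟨α', hα'⟩, hle⟩ := hgA α hα
    refine lift_mono le_rfl hle (lift_dual.2 ?_)
    have h1 := (lift_restrict hT (Y := PartOrd.dual.obj (Lang T At)) (X := X)
      (R := fun a y => Sat c v y (OrderDual.ofDual a))
      (fun a a' y y' ha hy h => sat_mono hT c v _ _ _ _ hy ha h)
      (PartOrd.dual.map (incl V)) (𝟙 X)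
      (R' := fun a y => Sat c v y (OrderDual.ofDual a).1) (fun _ _ => Iff.rfl)
      (OrderDual.ofDual α') (c x)).2 (by
        rw [T.map_id]
        exact lift_mono (map_dual_eq hα').le le_rfl ((sat_nabla_iff hT c v x α₀).1 (hA _ hα₀)))
    have h2 := lift_map (R := fun (a : PartOrd.dual.obj (Lang T At))
        (φ : PartOrd.dual.obj (upFunctor.obj (Lang T At))) =>
          OrderDual.ofDual a ∈ (OrderDual.ofDual φ : FinUp (Lang T At)))
      (PartOrd.dual.map (incl V)) (f ≫ PartOrd.dual.map (projUp (Lang T At)))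
      (fun a y h => (mem_map_posTheory hT c v hV).2 ⟨_, (OrderDual.ofDual a).2, h, le_rfl⟩) h1
    rw [← map_apply_comp] at h2
    exact lift_mono (map_dual_eq hα').ge le_rfl h2
  · obtain ⟨β₀, hβ₀, ⟨β', hβ'⟩, hle⟩ := hgB β hβ
    refine lift_mono hle le_rfl (lift_dual.2 ?_)
    have h1 := (lift_restrict hT (Y := X) (X := PartOrd.dual.obj (Lang T At))
      (R := fun y a => ¬ Sat c v y (OrderDual.ofDual a))
      (fun y y' a a' hy ha h h' => h (sat_mono hT c v _ _ _ _ hy ha h'))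
      (𝟙 X) (PartOrd.dual.map (incl W))
      (R' := fun y a => ¬ Sat c v y (OrderDual.ofDual a).1) (fun _ _ => Iff.rfl)
      (c x) (OrderDual.ofDual β')).2 (by
        rw [T.map_id]
        exact lift_mono le_rfl (map_dual_eq hβ').ge ((sat_delta hT c v x β₀).1 (hB _ hβ₀)))
    have h2 := lift_map (R := fun (ψ : PartOrd.dual.obj (lowFunctor.obj (Lang T At)))
        (b : PartOrd.dual.obj (Lang T At)) =>
          OrderDual.ofDual b ∈ (OrderDual.ofDual ψ : FinLow (Lang T At)))
      (f ≫ PartOrd.dual.map (projLow (Lang T At))) (PartOrd.dual.map (incl W))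
      (fun y a h => (mem_map_negTheory hT c v hW).2 ⟨_, (OrderDual.ofDual a).2, h, le_rfl⟩) h1
    rw [← map_apply_comp] at h2
    exact lift_mono le_rfl (map_dual_eq hβ').le h2
  -- Since `f` factors through its range, that range supports the redistribution and contains its
  -- base; each base element is thus the theory of some state `y`.
  · let S : Set (upLow (Lang T At)) := Set.range fun y => OrderDual.ofDual (f y)
    let k : X ⟶ PartOrd.dual.obj (PartOrd.of S) :=
      PartOrd.ofHom ⟨fun y => OrderDual.toDual ⟨OrderDual.ofDual (f y), y, rfl⟩,
        fun _ _ h => f.hom.monotone h⟩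
    have hS : (dualFunctor T).map (incl S) (OrderDual.toDual (T.map k (c x))) =
      OrderDual.toDual (T.map f (c x)) := map_apply_comp T k _ (c x)
    obtain ⟨y, rfl⟩ := base_subset ⟨_, hS⟩ hz
    refine ⟨y, fun a ha => ?_, fun b hb => ?_⟩
    · obtain ⟨a', -, ha', h⟩ := (mem_map_posTheory hT c v hV).1 ha
      exact sat_mono hT c v _ _ _ _ le_rfl h ha'
    · obtain ⟨b', -, hb', h⟩ := (mem_map_negTheory hT c v hW).1 hb
      exact fun hb => hb' (sat_mono hT c v _ _ _ _ le_rfl h hb)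

theorem Provable.not_refutes (hT : PreservesExactSquares T) (hi : PreservesFiniteIntersections T)
    {φ : FinUp (Lang T At)} {ψ : FinLow (Lang T At)} (h : Provable T At φ ψ) :
    ∀ (X : PartOrd.{u}) (c : X ⟶ T.obj X) (v : Valuation At X) (x : X), ¬ Refutes c v x φ ψ := by
  have hu : ∀ {φ ξ : FinUp (Lang T At)} {P : Lang T At → Prop},
      (∀ a ∈ φ ∪ ξ, P a) ↔ (∀ a ∈ φ, P a) ∧ ∀ a ∈ ξ, P a := by
    simp only [FinUp.mem_union, or_imp, forall_and, implies_true]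
  have hl : ∀ {φ ξ : FinLow (Lang T At)} {P : Lang T At → Prop},
      (∀ a ∈ φ ∪ ξ, P a) ↔ (∀ a ∈ φ, P a) ∧ ∀ a ∈ ξ, P a := by
    simp only [FinLow.mem_union, or_imp, forall_and, implies_true]
  have hu1 : ∀ {X : PartOrd.{u}} {c : X ⟶ T.obj X} {v : Valuation At X} {x : X} {a : Lang T At},
      (∀ b ∈ ({a} : FinUp (Lang T At)), Sat c v x b) ↔ Sat c v x a := fun {X c v x a} =>
    ⟨fun h => h a (FinUp.mem_singleton.2 le_rfl), fun h b hb =>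
      sat_mono hT c v _ _ _ _ le_rfl (FinUp.mem_singleton.1 hb) h⟩
  have hl1 : ∀ {X : PartOrd.{u}} {c : X ⟶ T.obj X} {v : Valuation At X} {x : X} {a : Lang T At},
      (∀ b ∈ ({a} : FinLow (Lang T At)), ¬ Sat c v x b) ↔ ¬ Sat c v x a := fun {X c v x a} =>
    ⟨fun h => h a (FinLow.mem_singleton.2 le_rfl), fun h b hb hs =>
      h (sat_mono hT c v _ _ _ _ le_rfl (FinLow.mem_singleton.1 hb) hs)⟩
  induction h with
  | ax a b h =>
    rintro X c v x ⟨h1, h2⟩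
    exact hl1.1 h2 (sat_mono hT c v _ _ _ _ le_rfl h (hu1.1 h1))
  | weakR φ ξ ψ h ih => exact fun X c v x h' => ih X c v x ⟨h'.1, (hl.1 h'.2).2⟩
  | weakL φ ξ ψ h ih => exact fun X c v x h' => ih X c v x ⟨(hu.1 h'.1).1, h'.2⟩
  | conjR φ ξ ψ h ih =>
    rintro X c v x ⟨h1, h2⟩
    obtain ⟨h2, h3⟩ := hl.1 h2
    exact hl1.1 h2 ((sat_conj hT c v x ξ).2 fun a ha => by_contra fun hn =>
      ih a ha X c v x ⟨h1, hl.2 ⟨hl1.2 hn, h3⟩⟩)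
  | conjL φ ξ ψ h ih =>
    rintro X c v x ⟨h1, h2⟩
    obtain ⟨h1, h3⟩ := hu.1 h1
    exact ih X c v x ⟨hu.2 ⟨h1, (sat_conj hT c v x ξ).1 (hu1.1 h3)⟩, h2⟩
  | disjR φ ψ ξ h ih =>
    rintro X c v x ⟨h1, h2⟩
    obtain ⟨h2, h3⟩ := hl.1 h2
    exact ih X c v x ⟨h1, hl.2 ⟨h2, fun a ha hs =>
      hl1.1 h3 ((sat_disj hT c v x ξ).2 ⟨a, ha, hs⟩)⟩⟩
  | disjL φ ψ ξ h ih =>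
    rintro X c v x ⟨h1, h2⟩
    obtain ⟨h1, h3⟩ := hu.1 h1
    obtain ⟨a, ha, hs⟩ := (sat_disj hT c v x ξ).1 (hu1.1 h3)
    exact ih a ha X c v x ⟨hu.2 ⟨h1, hu1.2 hs⟩, h2⟩
  | nablaR φ ψ α h ih =>
    rintro X c v x ⟨h1, h2⟩
    obtain ⟨h2, h3⟩ := hl.1 h2
    obtain ⟨Ψ, hΨ, hs⟩ := exists_setR_of_not_sat_nabla hT hi c v x α (hl1.1 h2)
    exact ih Ψ hΨ X c v x ⟨h1, hl.2 ⟨hl1.2 hs, h3⟩⟩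
  | deltaL φ ψ β h ih =>
    rintro X c v x ⟨h1, h2⟩
    obtain ⟨h1, h3⟩ := hu.1 h1
    obtain ⟨Φ, hΦ, hs⟩ := exists_setL_of_sat_delta hT hi c v x β (hu1.1 h3)
    exact ih Φ hΦ X c v x ⟨hu.2 ⟨h1, hu1.2 hs⟩, h2⟩
  | nablaDelta A B z hz h ih =>
    rintro X c v x ⟨h1, h2⟩
    obtain ⟨Φ, hΦ, hb⟩ := exists_redistribution hT hi c v x A B
      (fun α hα => h1 _ (FinUp.mem_map.2 ⟨α, hα, le_rfl⟩))
      (fun β hβ => h2 _ (FinLow.mem_map.2 ⟨β, hβ, le_rfl⟩))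
    obtain ⟨y, hy⟩ := hb _ (hz Φ hΦ)
    exact ih Φ hΦ X c v y hy

end Soundness

/-! ### Modal depth -/

section Depth

variable {T : PartOrd.{u} ⥤ PartOrd.{u}} {At : PartOrd.{u}}

theorem genBy_map_incl_up {V K : Set (Lang T At)} (h : V ⊆ K) (φ : FinUp V) :
    FinUp.GenBy K (FinUp.map (incl V).hom φ) :=
  (FinUp.genBy_range_iff.2 ⟨φ, rfl⟩).mono (by rintro _ ⟨a, rfl⟩; exact h a.2)

theorem genBy_map_incl_low {V K : Set (Lang T At)} (h : V ⊆ K) (ψ : FinLow V) :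
    FinLow.GenBy K (FinLow.map (incl V).hom ψ) :=
  (FinLow.genBy_range_iff.2 ⟨ψ, rfl⟩).mono (by rintro _ ⟨a, rfl⟩; exact h a.2)

theorem stageInj_inAtom (n : ℕ) (p : At) :
    stageInj T At (n + 1) (inAtom T At (stage T At n) p) = atom T At p := by
  induction n with
  | zero => exact stageInj_stageMap T At 0 p
  | succ n ih =>
    rw [← ih]
    exact stageInj_stageMap T At (n + 1) (inAtom T At (stage T At n) p)

theorem Refutes.mono {X : PartOrd.{u}} {c : X ⟶ T.obj X} {v : Valuation At X} {x : X}
    {φ φ' : FinUp (Lang T At)} {ψ ψ' : FinLow (Lang T At)}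
    (hφ : ∀ a ∈ φ, a ∈ φ') (hψ : ∀ b ∈ ψ, b ∈ ψ') (h : Refutes c v x φ' ψ') :
    Refutes c v x φ ψ :=
  ⟨fun a ha => h.1 a (hφ a ha), fun b hb => h.2 b (hψ b hb)⟩

variable [PreservesFilteredColimits T]

/-- The formulas built with `⋀` and `⋁` from atoms and from `∇α` and `Δα` for `α ∈ M`. -/
inductive BoolClosure (M : Set ((dualFunctor T).obj (Lang T At))) : Lang T At → Prop
  | atom (p : At) : BoolClosure M (atom T At p)
  | conj (s : Set (Lang T At)) (hs : s.Finite) (h : ∀ a ∈ s, BoolClosure M a) :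
      BoolClosure M (conj T At (FinUp.closure s hs))
  | disj (s : Set (Lang T At)) (hs : s.Finite) (h : ∀ a ∈ s, BoolClosure M a) :
      BoolClosure M (disj T At (FinLow.closure s hs))
  | nabla (α : (dualFunctor T).obj (Lang T At)) (h : α ∈ M) : BoolClosure M (nabla T At α)
  | delta (α : (dualFunctor T).obj (Lang T At)) (h : α ∈ M) : BoolClosure M (delta T At α)

theorem BoolClosure.mono {M M' : Set ((dualFunctor T).obj (Lang T At))} (hM : M ⊆ M')
    {a : Lang T At} (h : BoolClosure M a) : BoolClosure M' a := by
  induction h with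
  | atom p => exact .atom p
  | conj s hs h ih => exact .conj s hs ih
  | disj s hs h ih => exact .disj s hs ih
  | nabla α h => exact .nabla α (hM h)
  | delta α h => exact .delta α (hM h)

variable (T At) in
/-- The arguments of modalities in formulas of modal depth at most `n`. -/
def modalArgs : ℕ → Set ((dualFunctor T).obj (Lang T At))
  | 0 => ∅
  | n + 1 => Set.range ((dualFunctor T).map (incl {a | BoolClosure (modalArgs n) a}))

variable (T At) in
/-- The formulas of modal depth at most `n`. -/
def depthLE (n : ℕ) : Set (Lang T At) := {a | BoolClosure (modalArgs T At n) a}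

/-- At `n = 0` the truncated `n - 1` is harmless, as there are no modal arguments at all. -/
theorem modalArgs_subset_range (n : ℕ) :
    modalArgs T At n ⊆ Set.range ((dualFunctor T).map (incl (depthLE T At (n - 1)))) := by
  cases n with
  | zero => exact Set.empty_subset _
  | succ n => exact subset_rfl

theorem modalArgs_mono : Monotone (modalArgs T At) := by
  refine monotone_nat_of_le_succ fun n => ?_
  induction n with
  | zero => exact Set.empty_subset _
  | succ n ih => exact range_incl_mono fun a ha => ha.mono ih

theorem depthLE_mono : Monotone (depthLE T At) :=
  fun _ _ h _ ha => ha.mono (modalArgs_mono h)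

/-! ### Modal depth of connectives and of the premises of the modal rules. -/

theorem conj_mem_depthLE {n : ℕ} {φ : FinUp (Lang T At)} (h : FinUp.GenBy (depthLE T At n) φ) :
    conj T At φ ∈ depthLE T At n := by
  obtain ⟨s, hs, hsn, rfl⟩ := h.exists_closure
  exact .conj s hs hsn

theorem disj_mem_depthLE {n : ℕ} {ψ : FinLow (Lang T At)} (h : FinLow.GenBy (depthLE T At n) ψ) :
    disj T At ψ ∈ depthLE T At n := by
  obtain ⟨s, hs, hsn, rfl⟩ := h.exists_closure
  exact .disj s hs hsn

/-- Elements of L_β live over base(β), which lies in the formulas of the lower depth, and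
conjunctions of these keep that depth. Hence trading Δβ for ∇-formulas does not raise the modal
depth. -/
theorem map_conj_mem_modalArgs {n : ℕ} {β : (dualFunctor T).obj (Lang T At)}
    (hβ : β ∈ modalArgs T At n) {Φ} (hΦ : Φ ∈ setL T At β) :
    (dualFunctor T).map (conj T At) Φ ∈ modalArgs T At n := by
  cases n with
  | zero => exact hβ.elim
  | succ n =>
    have hb : base (dualFunctor T) β ⊆ depthLE T At n := base_subset hβ
    obtain ⟨Φ', rfl⟩ := hΦ.1
    rw [map_apply_comp]
    exact range_subset_of_fac (G := dualFunctor T) _ (incl (depthLE T At n)) (PartOrd.ofHom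
      ⟨fun φ => ⟨_, conj_mem_depthLE (genBy_map_incl_up hb φ)⟩, fun φ φ' h =>
        (conj T At).hom.monotone ((FinUp.map (incl _).hom).monotone h)⟩) rfl ⟨Φ', rfl⟩

theorem map_disj_mem_modalArgs {n : ℕ} {α : (dualFunctor T).obj (Lang T At)}
    (hα : α ∈ modalArgs T At n) {Ψ} (hΨ : Ψ ∈ setR T At α) :
    (dualFunctor T).map (disj T At) Ψ ∈ modalArgs T At n := by
  cases n with
  | zero => exact hα.elim
  | succ n =>
    have hb : base (dualFunctor T) α ⊆ depthLE T At n := base_subset hα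
    obtain ⟨Ψ', rfl⟩ := hΨ.1
    rw [map_apply_comp]
    exact range_subset_of_fac (G := dualFunctor T) _ (incl (depthLE T At n)) (PartOrd.ofHom
      ⟨fun ψ => ⟨_, disj_mem_depthLE (genBy_map_incl_low hb ψ)⟩, fun ψ ψ' h =>
        (disj T At).hom.monotone ((FinLow.map (incl _).hom).monotone h)⟩) rfl ⟨Ψ', rfl⟩

/-- Each stage of the construction adds at most one layer of modalities; hence every formula has
finite depth. -/
theorem stageInj_mem_depthLE (n : ℕ) (a : stage T At n) : stageInj T At n a ∈ depthLE T At n := by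
  induction n with
  | zero => exact .atom a
  | succ n ih =>
    have ih' : Set.range (stageInj T At n) ⊆ depthLE T At n := by
      rintro _ ⟨a, rfl⟩
      exact ih a
    have main : ∀ a : FinUp (stage T At n) ⊕ FinLow (stage T At n) ⊕
        (dualFunctor T).obj (stage T At n) ⊕ (dualFunctor T).obj (stage T At n) ⊕ At,
        stageInj T At (n + 1) a ∈ depthLE T At (n + 1) := by
      rintro (φ | ψ | α | α | p)
      · have e := operation_stage T At upFunctor (inUp T At) n φ
        refine Set.mem_of_eq_of_mem e.symm (conj_mem_depthLE ?_)
        exact (FinUp.genBy_range_iff.2 ⟨φ, rfl⟩).mono (ih'.trans (depthLE_mono n.le_succ))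
      · have e := operation_stage T At lowFunctor (inLow T At) n ψ
        refine Set.mem_of_eq_of_mem e.symm (disj_mem_depthLE ?_)
        exact (FinLow.genBy_range_iff.2 ⟨ψ, rfl⟩).mono (ih'.trans (depthLE_mono n.le_succ))
      · have e := operation_stage T At (dualFunctor T) (inNabla T At) n α
        exact Set.mem_of_eq_of_mem e.symm (.nabla _ (range_incl_mono ih'
          (range_subset_range_incl _ ⟨α, rfl⟩)))
      · have e := operation_stage T At (dualFunctor T) (inDelta T At) n α
        exact Set.mem_of_eq_of_mem e.symm (.delta _ (range_incl_mono ih'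
          (range_subset_range_incl _ ⟨α, rfl⟩)))
      · exact Set.mem_of_eq_of_mem (stageInj_inAtom n p) (.atom p)
    exact main a

theorem exists_genBy_depthLE (φ : FinUp (Lang T At)) (ψ : FinLow (Lang T At)) :
    ∃ n, FinUp.GenBy (depthLE T At n) φ ∧ FinLow.GenBy (depthLE T At n) ψ := by
  obtain ⟨n, φ, rfl⟩ := up_surj (stageSeq T At) φ
  obtain ⟨m, ψ, rfl⟩ := low_surj (stageSeq T At) ψ
  refine ⟨max n m, (FinUp.genBy_range_iff.2 ⟨φ, rfl⟩).mono ?_,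
    (FinLow.genBy_range_iff.2 ⟨ψ, rfl⟩).mono ?_⟩
  · rintro _ ⟨a, rfl⟩
    exact depthLE_mono (le_max_left n m) (stageInj_mem_depthLE n a)
  · rintro _ ⟨a, rfl⟩
    exact depthLE_mono (le_max_right n m) (stageInj_mem_depthLE m a)

end Depth

/-! ### Reduction of sequents to literals -/

section Reduction

variable {T : PartOrd.{u} ⥤ PartOrd.{u}} [PreservesFilteredColimits T] {At : PartOrd.{u}}

/-! ### Algebra of unions and direct images, and weakening along inclusions. -/

theorem FinUp.map_union {X Y : Type u} [PartialOrder X] [PartialOrder Y] (f : X →o Y)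
    (U V : FinUp X) : map f (U ∪ V) = map f U ∪ map f V := by
  refine ext fun a => ?_
  simp only [mem_union, mem_map, or_and_right, exists_or]

theorem FinUp.map_singleton {X Y : Type u} [PartialOrder X] [PartialOrder Y] (f : X →o Y)
    (x : X) : map f {x} = {f x} := by
  refine ext fun a => ?_
  simp only [mem_singleton, mem_map]
  exact ⟨fun ⟨y, hy, h⟩ => (f.monotone hy).trans h, fun h => ⟨x, le_rfl, h⟩⟩

theorem FinLow.map_union {X Y : Type u} [PartialOrder X] [PartialOrder Y] (f : X →o Y)
    (U V : FinLow X) : map f (U ∪ V) = map f U ∪ map f V := by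
  refine ext fun a => ?_
  simp only [mem_union, mem_map, or_and_right, exists_or]

theorem FinLow.map_singleton {X Y : Type u} [PartialOrder X] [PartialOrder Y] (f : X →o Y)
    (x : X) : map f {x} = {f x} := by
  refine ext fun a => ?_
  simp only [mem_singleton, mem_map]
  exact ⟨fun ⟨y, hy, h⟩ => h.trans (f.monotone hy), fun h => ⟨x, le_rfl, h⟩⟩

theorem FinUp.union_right_comm {X : Type u} [PartialOrder X] (U V W : FinUp X) :
    U ∪ V ∪ W = U ∪ W ∪ V := by
  refine ext fun a => ?_
  simp only [mem_union]
  tauto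

theorem FinUp.union_assoc {X : Type u} [PartialOrder X] (U V W : FinUp X) :
    U ∪ V ∪ W = U ∪ (V ∪ W) := by
  refine ext fun a => ?_
  simp only [mem_union, or_assoc]

theorem FinUp.union_comm {X : Type u} [PartialOrder X] (U V : FinUp X) : U ∪ V = V ∪ U := by
  refine ext fun a => ?_
  simp only [mem_union, or_comm]

theorem FinLow.union_right_comm {X : Type u} [PartialOrder X] (U V W : FinLow X) :
    U ∪ V ∪ W = U ∪ W ∪ V := by
  refine ext fun a => ?_
  simp only [mem_union]
  tauto

theorem FinLow.union_assoc {X : Type u} [PartialOrder X] (U V W : FinLow X) :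
    U ∪ V ∪ W = U ∪ (V ∪ W) := by
  refine ext fun a => ?_
  simp only [mem_union, or_assoc]

theorem FinLow.union_comm {X : Type u} [PartialOrder X] (U V : FinLow X) : U ∪ V = V ∪ U := by
  refine ext fun a => ?_
  simp only [mem_union, or_comm]

theorem Provable.mono {φ φ' : FinUp (Lang T At)} {ψ ψ' : FinLow (Lang T At)}
    (hφ : ∀ a ∈ φ, a ∈ φ') (hψ : ∀ b ∈ ψ, b ∈ ψ') (h : Provable T At φ ψ) :
    Provable T At φ' ψ' := by
  have e : φ ∪ φ' = φ' := FinUp.ext fun a => by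
    rw [FinUp.mem_union, or_iff_right_of_imp (hφ a)]
  have e' : ψ' ∪ ψ = ψ' := FinLow.ext fun a => by
    rw [FinLow.mem_union, or_iff_left_of_imp (hψ a)]
  rw [← e, ← e']
  exact .weakL _ _ _ (.weakR _ _ _ h)

variable (T At) in
/-- Unprovable sequents of atoms, formulas `∇α` on the left and formulas `Δβ` on the right, of
modal depth at most `n`. -/
structure OpenLiteral (n : ℕ) : Type u where
  posAtoms : FinUp At
  negAtoms : FinLow At
  nablas : FinUp ((dualFunctor T).obj (Lang T At))
  deltas : FinLow ((dualFunctor T).obj (Lang T At))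
  nablas_genBy : FinUp.GenBy (modalArgs T At n) nablas
  deltas_genBy : FinLow.GenBy (modalArgs T At n) deltas
  not_provable : ¬ Provable T At
    (FinUp.map (atom T At).hom posAtoms ∪ FinUp.map (nabla T At).hom nablas)
    (FinLow.map (atom T At).hom negAtoms ∪ FinLow.map (delta T At).hom deltas)

/-- The left-hand side. -/
noncomputable def OpenLiteral.left {n : ℕ} (s : OpenLiteral T At n) : FinUp (Lang T At) :=
  FinUp.map (atom T At).hom s.posAtoms ∪ FinUp.map (nabla T At).hom s.nablas

/-- The right-hand side. -/
noncomputable def OpenLiteral.right {n : ℕ} (s : OpenLiteral T At n) : FinLow (Lang T At) :=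
  FinLow.map (atom T At).hom s.negAtoms ∪ FinLow.map (delta T At).hom s.deltas

/-- Every refutation of `s` refutes `φ ⇒ ψ`. -/
def OpenLiteral.Reduces {n : ℕ} (s : OpenLiteral T At n) (φ : FinUp (Lang T At))
    (ψ : FinLow (Lang T At)) : Prop :=
  ∀ (X : PartOrd.{u}) (c : X ⟶ T.obj X) (v : Valuation At X) (x : X),
    Refutes c v x s.left s.right → Refutes c v x φ ψ

/-- The sequent `φ ⇒ ψ` together with any literals of depth at most `n` is provable or reduces to an
unprovable literal sequent. -/
def Reducible (n : ℕ) (φ : FinUp (Lang T At)) (ψ : FinLow (Lang T At)) : Prop :=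
  ∀ (P : FinUp At) (Q : FinLow At) (A : FinUp ((dualFunctor T).obj (Lang T At)))
    (B : FinLow ((dualFunctor T).obj (Lang T At))), FinUp.GenBy (modalArgs T At n) A →
    FinLow.GenBy (modalArgs T At n) B →
    ¬ Provable T At (φ ∪ (FinUp.map (atom T At).hom P ∪ FinUp.map (nabla T At).hom A))
      (ψ ∪ (FinLow.map (atom T At).hom Q ∪ FinLow.map (delta T At).hom B)) →
    ∃ s : OpenLiteral T At n,
      s.Reduces (φ ∪ (FinUp.map (atom T At).hom P ∪ FinUp.map (nabla T At).hom A))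
        (ψ ∪ (FinLow.map (atom T At).hom Q ∪ FinLow.map (delta T At).hom B))

/-- Adding `ξ` on the left preserves reducibility. -/
def ElimLeft (n : ℕ) (ξ : FinUp (Lang T At)) : Prop :=
  ∀ φ ψ, Reducible n φ ψ → Reducible n (φ ∪ ξ) ψ

/-- Adding `ξ` on the right preserves reducibility. -/
def ElimRight (n : ℕ) (ξ : FinLow (Lang T At)) : Prop :=
  ∀ φ ψ, Reducible n φ ψ → Reducible n φ (ψ ∪ ξ)

/-- One backward rule application: if unprovability passes from `a` to some eliminable `ξ` in every
context, and `ξ` semantically implies `a`, then `a` is eliminable. The side literals in `Reducible`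
are absorbed into the context. -/
theorem ElimLeft.of_step {n : ℕ} {a : FinUp (Lang T At)}
    (h : ∀ φ ψ, ¬ Provable T At (φ ∪ a) ψ → ∃ ξ, ¬ Provable T At (φ ∪ ξ) ψ ∧ ElimLeft n ξ ∧
      ∀ (X : PartOrd.{u}) (c : X ⟶ T.obj X) (v : Valuation At X) (x : X),
        (∀ b ∈ ξ, Sat c v x b) → ∀ b ∈ a, Sat c v x b) : ElimLeft n a := by
  intro φ ψ hr P Q A B hA hB hp
  rw [FinUp.union_right_comm] at hp ⊢
  obtain ⟨ξ, hξ, he, hs⟩ := h _ _ hp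
  rw [FinUp.union_right_comm] at hξ
  obtain ⟨s, hred⟩ := he φ ψ hr P Q A B hA hB hξ
  refine ⟨s, fun X c v x hx => ?_⟩
  have h1 := hred X c v x hx
  rw [FinUp.union_right_comm] at h1
  refine ⟨fun b hb => ?_, h1.2⟩
  rcases FinUp.mem_union.1 hb with hb | hb
  · exact h1.1 b (FinUp.mem_union.2 (Or.inl hb))
  · exact hs X c v x (fun b hb => h1.1 b (FinUp.mem_union.2 (Or.inr hb))) b hb

theorem ElimRight.of_step {n : ℕ} {a : FinLow (Lang T At)}
    (h : ∀ φ ψ, ¬ Provable T At φ (ψ ∪ a) → ∃ ξ, ¬ Provable T At φ (ψ ∪ ξ) ∧ ElimRight n ξ ∧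
      ∀ (X : PartOrd.{u}) (c : X ⟶ T.obj X) (v : Valuation At X) (x : X),
        (∀ b ∈ ξ, ¬ Sat c v x b) → ∀ b ∈ a, ¬ Sat c v x b) : ElimRight n a := by
  intro φ ψ hr P Q A B hA hB hp
  rw [FinLow.union_right_comm] at hp ⊢
  obtain ⟨ξ, hξ, he, hs⟩ := h _ _ hp
  rw [FinLow.union_right_comm] at hξ
  obtain ⟨s, hred⟩ := he φ ψ hr P Q A B hA hB hξ
  refine ⟨s, fun X c v x hx => ?_⟩
  have h1 := hred X c v x hx
  rw [FinLow.union_right_comm] at h1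
  refine ⟨h1.1, fun b hb => ?_⟩
  rcases FinLow.mem_union.1 hb with hb | hb
  · exact h1.2 b (FinLow.mem_union.2 (Or.inl hb))
  · exact hs X c v x (fun b hb => h1.2 b (FinLow.mem_union.2 (Or.inr hb))) b hb

theorem elimLeft_closure {n : ℕ} {s : Set (Lang T At)} (hs : s.Finite)
    (h : ∀ a ∈ s, ElimLeft n ({a} : FinUp (Lang T At))) : ElimLeft n (FinUp.closure s hs) := by
  induction s, hs using Set.Finite.induction_on with
  | empty =>
    intro φ ψ hr
    have e : φ ∪ FinUp.closure ∅ Set.finite_empty = φ := FinUp.ext fun a => by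
      simp [FinUp.mem_union, FinUp.mem_closure]
    rwa [e]
  | @insert a s _ hs ih =>
    intro φ ψ hr
    have e : φ ∪ FinUp.closure (insert a s) (hs.insert a) = φ ∪ FinUp.closure s hs ∪ {a} :=
      FinUp.ext fun b => by
        simp only [FinUp.mem_union, FinUp.mem_closure, FinUp.mem_singleton, Set.mem_insert_iff,
          or_and_right, exists_or, exists_eq_left, or_assoc]
        exact or_congr_right or_comm
    have h1 := h a (Set.mem_insert a s) _ _
      (ih (fun b hb => h b (Set.mem_insert_of_mem a hb)) φ ψ hr)
    rwa [← e] at h1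

theorem elimRight_closure {n : ℕ} {s : Set (Lang T At)} (hs : s.Finite)
    (h : ∀ a ∈ s, ElimRight n ({a} : FinLow (Lang T At))) : ElimRight n (FinLow.closure s hs) := by
  induction s, hs using Set.Finite.induction_on with
  | empty =>
    intro φ ψ hr
    have e : ψ ∪ FinLow.closure ∅ Set.finite_empty = ψ := FinLow.ext fun a => by
      simp [FinLow.mem_union, FinLow.mem_closure]
    rwa [e]
  | @insert a s _ hs ih =>
    intro φ ψ hr
    have e : ψ ∪ FinLow.closure (insert a s) (hs.insert a) = ψ ∪ FinLow.closure s hs ∪ {a} :=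
      FinLow.ext fun b => by
        simp only [FinLow.mem_union, FinLow.mem_closure, FinLow.mem_singleton, Set.mem_insert_iff,
          or_and_right, exists_or, exists_eq_left, or_assoc]
        exact or_congr_right or_comm
    have h1 := h a (Set.mem_insert a s) _ _
      (ih (fun b hb => h b (Set.mem_insert_of_mem a hb)) φ ψ hr)
    rwa [← e] at h1

/-! ### Literals are eliminated by moving them into the side literals. -/

theorem elimLeft_atom (n : ℕ) (p : At) : ElimLeft n ({atom T At p} : FinUp (Lang T At)) := by
  intro φ ψ hr P Q A B hA hB
  have h := hr ({p} ∪ P) Q A B hA hB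
  rw [FinUp.map_union, FinUp.map_singleton, FinUp.union_assoc, ← FinUp.union_assoc φ] at h
  exact h

theorem elimRight_atom (n : ℕ) (p : At) : ElimRight n ({atom T At p} : FinLow (Lang T At)) := by
  intro φ ψ hr P Q A B hA hB
  have h := hr P ({p} ∪ Q) A B hA hB
  rw [FinLow.map_union, FinLow.map_singleton, FinLow.union_assoc, ← FinLow.union_assoc ψ] at h
  exact h

theorem elimLeft_nabla {n : ℕ} {α : (dualFunctor T).obj (Lang T At)}
    (hα : α ∈ modalArgs T At n) : ElimLeft n ({nabla T At α} : FinUp (Lang T At)) := by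
  intro φ ψ hr P Q A B hA hB
  have h := hr P Q (A ∪ {α}) B (hA.union (FinUp.genBy_singleton hα)) hB
  rw [FinUp.map_union, FinUp.map_singleton, ← FinUp.union_assoc (FinUp.map _ P), ← FinUp.union_assoc φ,
    FinUp.union_right_comm] at h
  exact h

theorem elimRight_delta {n : ℕ} {β : (dualFunctor T).obj (Lang T At)}
    (hβ : β ∈ modalArgs T At n) : ElimRight n ({delta T At β} : FinLow (Lang T At)) := by
  intro φ ψ hr P Q A B hA hB
  have h := hr P Q A (B ∪ {β}) hA (hB.union (FinLow.genBy_singleton hβ))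
  rw [FinLow.map_union, FinLow.map_singleton, ← FinLow.union_assoc (FinLow.map _ Q), ← FinLow.union_assoc ψ,
    FinLow.union_right_comm] at h
  exact h

/-- Induction over ⋀ and ⋁ only. A ∇ on the right or a Δ on the left needs no induction hypothesis:
one backward step replaces it by a literal of the same depth bound. -/
theorem elim_of_mem_depthLE (hT : PreservesExactSquares T) {n : ℕ} {a : Lang T At}
    (ha : a ∈ depthLE T At n) : ElimLeft n {a} ∧ ElimRight n {a} := by
  have hu1 : ∀ {X : PartOrd.{u}} {c : X ⟶ T.obj X} {v : Valuation At X} {x : X} {a : Lang T At},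
      (∀ b ∈ ({a} : FinUp (Lang T At)), Sat c v x b) ↔ Sat c v x a := fun {X c v x a} =>
    ⟨fun h => h a (FinUp.mem_singleton.2 le_rfl), fun h b hb =>
      sat_mono hT c v _ _ _ _ le_rfl (FinUp.mem_singleton.1 hb) h⟩
  have hl1 : ∀ {X : PartOrd.{u}} {c : X ⟶ T.obj X} {v : Valuation At X} {x : X} {a : Lang T At},
      (∀ b ∈ ({a} : FinLow (Lang T At)), ¬ Sat c v x b) ↔ ¬ Sat c v x a := fun {X c v x a} =>
    ⟨fun h => h a (FinLow.mem_singleton.2 le_rfl), fun h b hb hs =>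
      h (sat_mono hT c v _ _ _ _ le_rfl (FinLow.mem_singleton.1 hb) hs)⟩
  induction ha with
  | atom p => exact ⟨elimLeft_atom n p, elimRight_atom n p⟩
  | conj s hs h ih =>
    constructor
    · refine .of_step fun φ ψ hp => ⟨FinUp.closure s hs, fun h => hp (.conjL _ _ _ h),
        elimLeft_closure hs fun a ha => (ih a ha).1, fun X c v x hx => ?_⟩
      exact hu1.2 ((sat_conj hT c v x _).2 hx)
    · refine .of_step fun φ ψ hp => ?_
      rw [FinLow.union_comm] at hp
      obtain ⟨a, ha, hpa⟩ : ∃ a ∈ FinUp.closure s hs, ¬ Provable T At φ ({a} ∪ ψ) := by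
        by_contra! hn
        exact hp (.conjR _ _ _ hn)
      -- The unprovable premise may concern any element of the upperset, while the induction
      -- hypothesis covers generators only. Passing to a generator b ≤ a shrinks the right-hand
      -- lowerset, so unprovability is kept.
      obtain ⟨b, hb, hba⟩ := FinUp.mem_closure.1 ha
      refine ⟨{b}, fun h => hpa (h.mono (fun _ h => h) fun d hd => ?_), (ih b hb).2,
        fun X c v x hx => ?_⟩
      · rw [FinLow.mem_union, FinLow.mem_singleton] at hd ⊢
        exact hd.symm.imp_left fun h => h.trans hba
      · exact hl1.2 fun h => hl1.1 hx
          ((sat_conj hT c v x _).1 h b (FinUp.mem_closure.2 ⟨b, hb, le_rfl⟩))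
  | disj s hs h ih =>
    constructor
    · refine .of_step fun φ ψ hp => ?_
      obtain ⟨a, ha, hpa⟩ : ∃ a ∈ FinLow.closure s hs, ¬ Provable T At (φ ∪ {a}) ψ := by
        by_contra! hn
        exact hp (.disjL _ _ _ hn)
      obtain ⟨b, hb, hba⟩ := FinLow.mem_closure.1 ha
      refine ⟨{b}, fun h => hpa (h.mono (fun d hd => ?_) fun _ h => h), (ih b hb).1,
        fun X c v x hx => ?_⟩
      · rw [FinUp.mem_union, FinUp.mem_singleton] at hd ⊢
        exact hd.imp_right fun h => hba.trans h
      · exact hu1.2 ((sat_disj hT c v x _).2 ⟨b, FinLow.mem_closure.2 ⟨b, hb, le_rfl⟩, hu1.1 hx⟩)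
    · refine .of_step fun φ ψ hp => ⟨FinLow.closure s hs, fun h => hp (.disjR _ _ _ h),
        elimRight_closure hs fun a ha => (ih a ha).2, fun X c v x hx => ?_⟩
      refine hl1.2 fun h => ?_
      obtain ⟨a, ha, hsat⟩ := (sat_disj hT c v x _).1 h
      exact hx a ha hsat
  | nabla α hα =>
    refine ⟨elimLeft_nabla hα, .of_step fun φ ψ hp => ?_⟩
    rw [FinLow.union_comm] at hp
    obtain ⟨Ψ, hΨ, hpΨ⟩ : ∃ Ψ ∈ setR T At α, ¬ Provable T At φ
        ({delta T At ((dualFunctor T).map (disj T At) Ψ)} ∪ ψ) := by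
      by_contra! hn
      exact hp (.nablaR _ _ _ hn)
    rw [FinLow.union_comm] at hpΨ
    exact ⟨_, hpΨ, elimRight_delta (map_disj_mem_modalArgs hα hΨ), fun X c v x hx =>
      hl1.2 (not_sat_nabla_of_setR hT c v x α hΨ (hl1.1 hx))⟩
  | delta β hβ =>
    refine ⟨.of_step fun φ ψ hp => ?_, elimRight_delta hβ⟩
    obtain ⟨Φ, hΦ, hpΦ⟩ : ∃ Φ ∈ setL T At β, ¬ Provable T At
        (φ ∪ {nabla T At ((dualFunctor T).map (conj T At) Φ)}) ψ := by
      by_contra! hn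
      exact hp (.deltaL _ _ _ hn)
    exact ⟨_, hpΦ, elimLeft_nabla (map_conj_mem_modalArgs hβ hΦ), fun X c v x hx =>
      hu1.2 (sat_delta_of_setL hT c v x β hΦ (hu1.1 hx))⟩

/-- The empty sequent is reducible since only side literals remain; the finitely many generators of
both sides are then added one at a time. -/
theorem exists_reduces (hT : PreservesExactSquares T) {n : ℕ} {φ : FinUp (Lang T At)}
    {ψ : FinLow (Lang T At)} (hφ : FinUp.GenBy (depthLE T At n) φ)
    (hψ : FinLow.GenBy (depthLE T At n) ψ) (hp : ¬ Provable T At φ ψ) :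
    ∃ s : OpenLiteral T At n, s.Reduces φ ψ := by
  obtain ⟨s, hs, hsn, rfl⟩ := hφ.exists_closure
  obtain ⟨t, ht, htn, rfl⟩ := hψ.exists_closure
  have h0 : Reducible n (FinUp.closure ∅ Set.finite_empty : FinUp (Lang T At))
      (FinLow.closure ∅ Set.finite_empty) := by
    intro P Q A B hA hB hp
    refine ⟨⟨P, Q, A, B, hA, hB, fun h => hp (h.mono ?_ ?_)⟩, fun X c v x hx => hx.mono ?_ ?_⟩
    · exact fun a ha => FinUp.mem_union.2 (Or.inr ha)
    · exact fun a ha => FinLow.mem_union.2 (Or.inr ha)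
    · intro a ha
      rcases FinUp.mem_union.1 ha with ha | ha
      · obtain ⟨_, h, -⟩ := FinUp.mem_closure.1 ha
        exact h.elim
      · exact ha
    · intro a ha
      rcases FinLow.mem_union.1 ha with ha | ha
      · obtain ⟨_, h, -⟩ := FinLow.mem_closure.1 ha
        exact h.elim
      · exact ha
  have h1 := elimLeft_closure hs (fun a ha => (elim_of_mem_depthLE hT (hsn ha)).1) _ _ h0
  have h2 := elimRight_closure ht (fun a ha => (elim_of_mem_depthLE hT (htn ha)).2) _ _ h1
  have hempty : ∀ {X : PartOrd.{u}} (K : Set X),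
      FinUp.GenBy K (FinUp.closure ∅ Set.finite_empty) ∧
        FinLow.GenBy K (FinLow.closure ∅ Set.finite_empty) := fun K =>
    ⟨FinUp.genBy_closure (Set.empty_subset K), FinLow.genBy_closure (Set.empty_subset K)⟩
  obtain ⟨r, hr⟩ := h2 (FinUp.closure ∅ Set.finite_empty) (FinLow.closure ∅ Set.finite_empty)
    (FinUp.closure ∅ Set.finite_empty) (FinLow.closure ∅ Set.finite_empty)
    (hempty _).1 (hempty _).2 (fun h => hp (h.mono
      (fun a ha => by simpa [FinUp.mem_union, FinUp.mem_map, FinUp.mem_closure] using ha)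
      (fun a ha => by simpa [FinLow.mem_union, FinLow.mem_map, FinLow.mem_closure] using ha)))
  exact ⟨r, fun X c v x hx => (hr X c v x hx).mono
    (fun a ha => FinUp.mem_union.2 (Or.inl (FinUp.mem_union.2 (Or.inr ha))))
    fun a ha => FinLow.mem_union.2 (Or.inl (FinLow.mem_union.2 (Or.inr ha)))⟩

end Reduction

/-! ### Completeness -/

section Completeness

/-- The discrete poset on a type. -/
def Discrete (α : Type u) : PartOrd.{u} :=
  @PartOrd.of α
    { le := Eq
      le_refl := fun _ => rfl
      le_trans := fun _ _ _ => Eq.trans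
      le_antisymm := fun _ _ h _ => h }

/-- Every function on a discrete poset is monotone. -/
def Discrete.desc {α : Type u} {X : PartOrd.{u}} (f : α → X) : Discrete α ⟶ X :=
  @PartOrd.ofHom α X (Discrete α).str _
    (@OrderHom.mk α X (Discrete α).str.toPreorder _ f fun _ _ h => (congrArg f h).le)

variable {T : PartOrd.{u} ⥤ PartOrd.{u}} [PreservesFilteredColimits T] {At : PartOrd.{u}}

/-- If every redistribution had a provable sequent in its base, choosing one for each would be an
instance of ∇Δ. -/
theorem OpenLiteral.exists_redistribution {n : ℕ} (s : OpenLiteral T At n) :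
    ∃ Φ ∈ redistributions T At s.nablas s.deltas,
      ∀ z ∈ base (dualFunctor T) Φ, ¬ Provable T At z.1 z.2 := by
  by_contra! h
  choose z hz hp using h
  exact s.not_provable ((Provable.nablaDelta _ _ z hz hp).mono
    (fun a ha => FinUp.mem_union.2 (Or.inr ha)) fun a ha => FinLow.mem_union.2 (Or.inr ha))

/-- Produces the value of the coalgebra at `s`. The relation `N y φ ψ` stands for "y represents the
unprovable sequent φ ⇒ ψ"; satisfaction is not mentioned, since the coalgebra must exist before
truth in it can be discussed. -/
theorem OpenLiteral.exists_successor (hT : PreservesExactSquares T)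
    (hi : PreservesFiniteIntersections T) {n : ℕ} (s : OpenLiteral T At n) {X : PartOrd.{u}}
    (N : X → FinUp (Lang T At) → FinLow (Lang T At) → Prop)
    (hN : ∀ φ ψ, FinUp.GenBy (depthLE T At (n - 1)) φ → FinLow.GenBy (depthLE T At (n - 1)) ψ →
      ¬ Provable T At φ ψ → ∃ x, N x φ ψ) :
    ∃ t : T.obj X,
      (∀ α ∈ s.nablas, lift T (Y := PartOrd.dual.obj (Lang T At)) (X := X)
        (fun a y => ∃ φ ψ, N y φ ψ ∧ OrderDual.ofDual a ∈ φ) (OrderDual.ofDual α) t) ∧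
      ∀ β ∈ s.deltas, lift T (Y := X) (X := PartOrd.dual.obj (Lang T At))
        (fun y b => ∃ φ ψ, N y φ ψ ∧ OrderDual.ofDual b ∈ ψ) t (OrderDual.ofDual β) := by
  obtain ⟨Φ, hΦ, hp⟩ := s.exists_redistribution
  have hV : base (dualFunctor T ⋙ upFunctor) s.nablas ⊆ depthLE T At (n - 1) :=
    base_subset (FinUp.genBy_range_iff.1 (s.nablas_genBy.mono (modalArgs_subset_range n)))
  have hW : base (dualFunctor T ⋙ lowFunctor) s.deltas ⊆ depthLE T At (n - 1) :=
    base_subset (FinLow.genBy_range_iff.1 (s.deltas_genBy.mono (modalArgs_subset_range n)))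
  -- The redistribution lives over the bases of the two sides, so each sequent in its base is
  -- generated by formulas of depth at most `n - 1`.
  have hx : ∀ z : base (dualFunctor T) Φ, ∃ x, N x z.1.1 z.1.2 := by
    rintro ⟨z, hz⟩
    obtain ⟨⟨φ, ψ⟩, rfl⟩ := base_subset_range hΦ.1 hz
    exact hN _ _ (genBy_map_incl_up hV φ) (genBy_map_incl_low hW ψ) (hp _ hz)
  choose f hf using hx
  obtain ⟨-, Φ', hΦ'⟩ := base_dual_spec hi Φ
  -- The choice `f` of representatives need not be monotone. As `T` preserves the surjection `e`,
  -- the redistribution lifts to the discrete poset on its base, on which `f` is a morphism.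
  let e : Discrete (base (dualFunctor T) Φ) ⟶
    PartOrd.dual.obj (PartOrd.of (base (dualFunctor T) Φ)) := Discrete.desc OrderDual.toDual
  obtain ⟨w, hw⟩ := hT.surjective e (fun z => ⟨OrderDual.ofDual z, rfl⟩) (OrderDual.ofDual Φ')
  let g : Discrete (base (dualFunctor T) Φ) ⟶ PartOrd.dual.obj (upLow (Lang T At)) :=
    e ≫ PartOrd.dual.map (incl (base (dualFunctor T) Φ))
  have hg : T.map g w = OrderDual.ofDual Φ := by
    rw [← map_apply_comp, hw]
    exact map_dual_eq hΦ'
  refine ⟨T.map (Discrete.desc f) w, fun α hα => ?_, fun β hβ => ?_⟩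
  · have h1 := lift_dual.1 (hΦ.2.1 α hα)
    have h2 := (lift_restrict hT (Y := PartOrd.dual.obj (Lang T At))
      (X := PartOrd.dual.obj (upFunctor.obj (Lang T At)))
      (R := fun a φ => OrderDual.ofDual a ∈ (OrderDual.ofDual φ : FinUp (Lang T At)))
      (fun a a' φ φ' ha hφ h => FinUp.le_iff.1 hφ _ (FinUp.mem_of_le ha h))
      (𝟙 _) (g ≫ PartOrd.dual.map (projUp (Lang T At)))
      (R' := fun a (z : base (dualFunctor T) Φ) => OrderDual.ofDual a ∈ z.1.1)
      (fun _ _ => Iff.rfl) (OrderDual.ofDual α) w).2 (by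
        rw [T.map_id, ← map_apply_comp, hg]
        exact h1)
    have h3 := lift_map (R := fun (a : PartOrd.dual.obj (Lang T At)) (y : X) =>
      ∃ φ ψ, N y φ ψ ∧ OrderDual.ofDual a ∈ φ) (𝟙 _) (Discrete.desc f)
      (fun a z h => ⟨_, _, hf z, h⟩) h2
    rw [T.map_id] at h3
    exact h3
  · have h1 := lift_dual.1 (hΦ.2.2 β hβ)
    have h2 := (lift_restrict hT (Y := PartOrd.dual.obj (lowFunctor.obj (Lang T At)))
      (X := PartOrd.dual.obj (Lang T At))
      (R := fun ψ b => OrderDual.ofDual b ∈ (OrderDual.ofDual ψ : FinLow (Lang T At)))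
      (fun ψ ψ' b b' hψ hb h => FinLow.le_iff.1 hψ _ (FinLow.mem_of_le hb h))
      (g ≫ PartOrd.dual.map (projLow (Lang T At))) (𝟙 _)
      (R' := fun (z : base (dualFunctor T) Φ) b => OrderDual.ofDual b ∈ z.1.2)
      (fun _ _ => Iff.rfl) w (OrderDual.ofDual β)).2 (by
        rw [T.map_id, ← map_apply_comp, hg]
        exact h1)
    have h3 := lift_map (R := fun (y : X) (b : PartOrd.dual.obj (Lang T At)) =>
      ∃ φ ψ, N y φ ψ ∧ OrderDual.ofDual b ∈ ψ) (Discrete.desc f) (𝟙 _)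
      (fun z b h => ⟨_, _, hf z, h⟩) h2
    rw [T.map_id] at h3
    exact h3

variable (T At) in
/-- The states of the canonical model. -/
abbrev canonicalStates : PartOrd.{u} := Discrete (Σ n, OpenLiteral T At n)

/-- The valuation of the canonical model. -/
def canonicalValuation : Valuation At (canonicalStates T At) where
  holds x p := p ∈ x.2.posAtoms
  mono := by
    rintro x _ p q rfl hpq hp
    exact FinUp.mem_of_le hpq hp

/-- The state `x` is one level below `n` and reduces `φ ⇒ ψ`. -/
def IsSuccessor (n : ℕ) (x : canonicalStates T At) (φ : FinUp (Lang T At))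
    (ψ : FinLow (Lang T At)) : Prop :=
  x.1 = n - 1 ∧ x.2.Reduces φ ψ

theorem exists_canonicalCoalgebra (hT : PreservesExactSquares T)
    (hi : PreservesFiniteIntersections T) :
    ∃ c : canonicalStates T At ⟶ T.obj (canonicalStates T At), ∀ x : canonicalStates T At,
      (∀ α ∈ x.2.nablas, lift T (Y := PartOrd.dual.obj (Lang T At)) (X := canonicalStates T At)
        (fun a y => ∃ φ ψ, IsSuccessor x.1 y φ ψ ∧ OrderDual.ofDual a ∈ φ)
        (OrderDual.ofDual α) (c x)) ∧
      ∀ β ∈ x.2.deltas, lift T (Y := canonicalStates T At) (X := PartOrd.dual.obj (Lang T At))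
        (fun y b => ∃ φ ψ, IsSuccessor x.1 y φ ψ ∧ OrderDual.ofDual b ∈ ψ)
        (c x) (OrderDual.ofDual β) := by
  choose t ht using fun x : canonicalStates T At =>
    x.2.exists_successor hT hi (X := canonicalStates T At) (IsSuccessor x.1)
      (fun φ ψ hφ hψ hp =>
        let ⟨s, hs⟩ := exists_reduces hT hφ hψ hp
        ⟨⟨_, s⟩, rfl, hs⟩)
  exact ⟨Discrete.desc t, ht⟩

/-- The truth lemma, by strong induction on the level: by hypothesis successors refute themselves,
hence also the sequents they reduce, and monotonicity of lifting in the relation turns the lifted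
membership relations into ∇ and failure of Δ. -/
theorem exists_canonicalModel (hT : PreservesExactSquares T)
    (hi : PreservesFiniteIntersections T) :
    ∃ (c : canonicalStates T At ⟶ T.obj (canonicalStates T At)),
      ∀ (n : ℕ) (s : OpenLiteral T At n),
        Refutes c canonicalValuation (⟨n, s⟩ : Σ n, OpenLiteral T At n) s.left s.right := by
  obtain ⟨c, hc⟩ := exists_canonicalCoalgebra (At := At) hT hi
  refine ⟨c, fun n => ?_⟩
  induction n using Nat.strong_induction_on with
  | _ n ih =>
  intro s
  -- Level 0 states have their successors at level 0, but they contain no modal formulas, so there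
  -- the induction hypothesis is never needed.
  have hsucc : ∀ α ∈ modalArgs T At n, n - 1 < n := by
    intro α hα
    cases n with
    | zero => exact hα.elim
    | succ n => exact n.lt_succ_self
  have hRef : n - 1 < n → ∀ y φ ψ, IsSuccessor n y φ ψ → Refutes c canonicalValuation y φ ψ := by
    rintro hn ⟨m, r⟩ φ ψ ⟨rfl, hr⟩
    exact hr _ c _ _ (ih _ hn r)
  obtain ⟨h1, h2⟩ := hc (⟨n, s⟩ : Σ n, OpenLiteral T At n)
  constructor
  · intro a ha
    rcases FinUp.mem_union.1 ha with ha | ha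
    · obtain ⟨p, hp, hpa⟩ := FinUp.mem_map.1 ha
      exact sat_mono hT c _ _ _ _ _ le_rfl hpa ((sat_atom hT c _ _ p).2 hp)
    · obtain ⟨α, hα, hαa⟩ := FinUp.mem_map.1 ha
      obtain ⟨α', -, hα', -⟩ := s.nablas_genBy α hα
      refine sat_mono hT c _ _ _ _ _ le_rfl hαa ((sat_nabla_iff hT c _ _ α).2 ?_)
      refine lift_imp ?_ (h1 α hα)
      rintro a y ⟨φ, ψ, hN, ha⟩
      exact (hRef (hsucc α' hα') y φ ψ hN).1 _ ha
  · intro a ha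
    rcases FinLow.mem_union.1 ha with ha | ha
    · obtain ⟨q, hq, hqa⟩ := FinLow.mem_map.1 ha
      intro hs
      -- If an atom of the right-hand side held, it would also lie on the left, and the sequent
      -- would be a weakening of an axiom.
      have hqP : q ∈ s.posAtoms :=
        (sat_atom hT c _ _ q).1 (sat_mono hT c _ _ _ _ _ le_rfl hqa hs)
      refine s.not_provable ((Provable.ax _ _ (le_refl (atom T At q))).mono
        (fun b hb => FinUp.mem_union.2 (Or.inl (FinUp.mem_map.2 ⟨q, hqP, ?_⟩)))
        fun b hb => FinLow.mem_union.2 (Or.inl (FinLow.mem_map.2 ⟨q, hq, ?_⟩)))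
      · exact FinUp.mem_singleton.1 hb
      · exact FinLow.mem_singleton.1 hb
    · obtain ⟨β, hβ, hβa⟩ := FinLow.mem_map.1 ha
      obtain ⟨β', -, hβ', -⟩ := s.deltas_genBy β hβ
      intro hs
      refine (sat_delta hT c _ _ β).2 ?_ (sat_mono hT c _ _ _ _ _ le_rfl hβa hs)
      refine lift_imp ?_ (h2 β hβ)
      rintro y b ⟨φ, ψ, hN, hb⟩
      exact (hRef (hsucc β' hβ') y φ ψ hN).2 _ hb

theorem provable_of_valid (hT : PreservesExactSquares T) (hi : PreservesFiniteIntersections T)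
    {φ : FinUp (Lang T At)} {ψ : FinLow (Lang T At)} (h : Valid T At φ ψ) :
    Provable T At φ ψ := by
  by_contra hp
  obtain ⟨n, hφ, hψ⟩ := exists_genBy_depthLE φ ψ
  obtain ⟨s, hs⟩ := exists_reduces hT hφ hψ hp
  obtain ⟨c, hc⟩ := exists_canonicalModel (At := At) hT hi
  exact (valid_iff hT φ ψ).1 h _ c _ _ (hs _ c _ _ (hc n s))

end Completeness

end MossPos

theorem mainTheorem1 (T : PartOrd.{u} ⥤ PartOrd.{u}) [PreservesFilteredColimits T]
    (hmono : MossPos.LocallyMonotone T) (hexact : MossPos.PreservesExactSquares T)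
    (hinter : MossPos.PreservesFiniteIntersections T) (At : PartOrd.{u})
    (φ : MossPos.FinUp (MossPos.Lang T At)) (ψ : MossPos.FinLow (MossPos.Lang T At)) :
    MossPos.Valid T At φ ψ ↔ MossPos.Provable T At φ ψ :=
  ⟨MossPos.provable_of_valid hexact hinter,
    fun h => (MossPos.valid_iff hexact φ ψ).2 (h.not_refutes hexact hinter)⟩
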